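/- Let $\mathcal H=\bigoplus_{n\ge1}L^2[0,\pi/n]$ be the $\ell^2$ direct sum of Hilbert spaces, and let $\Delta$ be the Dirichlet Laplacian of the infinite quantum graph with edge lengths $\pi/n$, i.e. $\Delta\psi=(\psi_n'')_{n\ge1}$ on the domain of all $\psi=(\psi_n)\in\mathcal H$ with $\psi_n\in H^2(0,\pi/n)$, $(\psi_n'')_{n\ge1}\in\mathcal H$ and $\psi_n(0)=\psi_n(\pi/n)=0$ for all $n$. Let $d(n)$ denote the number of positive divisors of $n$ and let $K=\{k\in\mathbb C:\ |\operatorname{Im}k|<\sqrt{1+(\operatorname{Re}k)^2}\}$. For $k\in K$ and $\operatorname{Re}s>\tfrac12$ the generalized spectral zeta function $$\zeta_\Delta(s,k)=\operatorname{tr}\bigl((-\Delta+k^2)^{-s}\bigr)=\sum_{\mu}\operatorname{mult}(\mu)\,(\mu+k^2)^{-s}=\sum_{n=1}^\infty\frac{d(n)}{(n^2+k^2)^s}$$ (sum over the eigenvalues $\mu$ of $-\Delta$ with their multiplicities; principal branch of the power) converges absolutely. For each $k\in K$ it has, as a function of $s$, a meromorphic continuation to $\mathbb C$ that is holomorphic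 at $s=0$, so that the functional determinant $$\det(-\Delta+k^2):=\exp\Bigl(-\frac{\partial\zeta_\Delta(s,k)}{\partial s}\Big|_{s=0}\Bigr),\qquad k\in K,$$ is well defined. Theorem. The function $k\mapsto\det(-\Delta+k^2)$, $k\in K$, extends to an entire function of $k\in\mathbb C$. The extension is the Weierstrass product $$D(k^2)=\frac1{2\pi}\prod_{n=1}^\infty\Bigl(1+\frac{k^2}{n^2}\Bigr)^{d(n)},\qquad k\in\mathbb C,$$ which converges for every $k\in\mathbb C$. In particular $\det(-\Delta)=D(0)=\frac1{2\pi}$. -/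

import Mathlib

open MeasureTheory
open scoped ENNReal ContDiff

namespace QuantumGraph

/-- Lebesgue measure on the interval `[0, L]`. -/
noncomputable def edgeMeasure (L : ℝ) : Measure ℝ := volume.restrict (Set.Icc 0 L)

instance (L : ℝ) : IsFiniteMeasure (edgeMeasure L) := by
  unfold edgeMeasure; infer_instance

/-- The complex Hilbert space `L²[0, L]`. -/
abbrev EdgeSpace (L : ℝ) : Type := Lp ℂ 2 (edgeMeasure L)

/-- The length `π / n` of the `n`-th edge. -/
noncomputable def edgeLength (n : ℕ+) : ℝ := Real.pi / (n : ℕ)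

/-- The Hilbert space of the infinite quantum graph: the `ℓ²` direct sum of the spaces
`L²[0, π / n]`, `n = 1, 2, 3, …`. -/
abbrev GraphSpace : Type := lp (fun n : ℕ+ => EdgeSpace (edgeLength n)) 2

/-- `v ∈ L²` is the weak derivative of `u ∈ L²` on the open interval `(0, L)`. -/
def HasWeakDeriv {L : ℝ} (u v : EdgeSpace L) : Prop :=
  ∀ φ : ℝ → ℝ, ContDiff ℝ ∞ φ → HasCompactSupport φ → tsupport φ ⊆ Set.Ioo 0 L →
    ∫ x, deriv φ x • u x ∂(edgeMeasure L) = - ∫ x, φ x • v x ∂(edgeMeasure L)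

/-- `u` has a representative that is continuous on `[0, L]` and vanishes at both ends. -/
def VanishesAtEnds {L : ℝ} (u : EdgeSpace L) : Prop :=
  ∃ f : ℝ → ℂ, ContinuousOn f (Set.Icc 0 L) ∧ u =ᵐ[edgeMeasure L] f ∧ f 0 = 0 ∧ f L = 0

/-- `u` belongs to the Sobolev space `H²(0, L)`, satisfies the Dirichlet conditions at both ends,
and `w` is its second weak derivative. -/
def IsDirichletSecondDeriv {L : ℝ} (u w : EdgeSpace L) : Prop :=
  (∃ v : EdgeSpace L, HasWeakDeriv u v ∧ HasWeakDeriv v w) ∧ VanishesAtEnds u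

theorem integrable_smul {L : ℝ} (u : EdgeSpace L) {g : ℝ → ℝ} (hg : Continuous g)
    (hc : HasCompactSupport g) : Integrable (fun x => g x • u x) (edgeMeasure L) := by
  obtain ⟨C, hC⟩ := hc.exists_bound_of_continuous hg
  have hu : Integrable (fun x => u x) (edgeMeasure L) :=
    (Lp.memLp u).integrable (by norm_num)
  exact hu.bdd_smul C hg.aestronglyMeasurable (Filter.Eventually.of_forall hC)

theorem HasWeakDeriv.add {L : ℝ} {u₁ v₁ u₂ v₂ : EdgeSpace L} (h₁ : HasWeakDeriv u₁ v₁)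
    (h₂ : HasWeakDeriv u₂ v₂) : HasWeakDeriv (u₁ + u₂) (v₁ + v₂) := by
  intro φ hφ hc hs
  have hd : Continuous (deriv φ) := hφ.continuous_deriv (by simp)
  have e1 : ∫ x, deriv φ x • (u₁ + u₂) x ∂(edgeMeasure L)
      = ∫ x, (deriv φ x • u₁ x + deriv φ x • u₂ x) ∂(edgeMeasure L) := by
    refine integral_congr_ae ?_
    filter_upwards [Lp.coeFn_add u₁ u₂] with x hx
    rw [hx, Pi.add_apply, smul_add]
  have e2 : ∫ x, φ x • (v₁ + v₂) x ∂(edgeMeasure L)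
      = ∫ x, (φ x • v₁ x + φ x • v₂ x) ∂(edgeMeasure L) := by
    refine integral_congr_ae ?_
    filter_upwards [Lp.coeFn_add v₁ v₂] with x hx
    rw [hx, Pi.add_apply, smul_add]
  rw [e1, e2, integral_add (integrable_smul u₁ hd hc.deriv) (integrable_smul u₂ hd hc.deriv),
    integral_add (integrable_smul v₁ hφ.continuous hc) (integrable_smul v₂ hφ.continuous hc),
    h₁ φ hφ hc hs, h₂ φ hφ hc hs]
  ring

theorem HasWeakDeriv.smul {L : ℝ} {u v : EdgeSpace L} (c : ℂ) (h : HasWeakDeriv u v) :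
    HasWeakDeriv (c • u) (c • v) := by
  intro φ hφ hc hs
  have e1 : ∫ x, deriv φ x • (c • u) x ∂(edgeMeasure L)
      = ∫ x, c • (deriv φ x • u x) ∂(edgeMeasure L) := by
    refine integral_congr_ae ?_
    filter_upwards [Lp.coeFn_smul c u] with x hx
    rw [hx, Pi.smul_apply, smul_comm]
  have e2 : ∫ x, φ x • (c • v) x ∂(edgeMeasure L)
      = ∫ x, c • (φ x • v x) ∂(edgeMeasure L) := by
    refine integral_congr_ae ?_
    filter_upwards [Lp.coeFn_smul c v] with x hx
    rw [hx, Pi.smul_apply, smul_comm]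
  rw [e1, e2, integral_smul, integral_smul, h φ hφ hc hs, smul_neg]

theorem hasWeakDeriv_zero {L : ℝ} : HasWeakDeriv (0 : EdgeSpace L) 0 := by
  have h0 : ∀ g : ℝ → ℝ, ∫ x, g x • (0 : EdgeSpace L) x ∂(edgeMeasure L) = 0 := by
    intro g
    refine integral_eq_zero_of_ae ?_
    filter_upwards [Lp.coeFn_zero ℂ 2 (edgeMeasure L)] with x hx
    rw [hx, Pi.zero_apply, smul_zero]
  intro φ _ _ _
  rw [h0, h0, neg_zero]

/-- Weak derivatives are unique. -/
theorem HasWeakDeriv.eq_zero {L : ℝ} {v : EdgeSpace L} (h : HasWeakDeriv 0 v) : v = 0 := by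
  have h0 : ∀ g : ℝ → ℝ, ∫ x, g x • (0 : EdgeSpace L) x ∂(edgeMeasure L) = 0 := by
    intro g
    refine integral_eq_zero_of_ae ?_
    filter_upwards [Lp.coeFn_zero ℂ 2 (edgeMeasure L)] with x hx
    rw [hx, Pi.zero_apply, smul_zero]
  have hv : Integrable (fun x => v x) (edgeMeasure L) :=
    (Lp.memLp v).integrable (by norm_num)
  have key : ∀ᵐ x ∂(edgeMeasure L), x ∈ Set.Ioo 0 L → v x = 0 := by
    refine isOpen_Ioo.ae_eq_zero_of_integral_contDiff_smul_eq_zero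
      (hv.locallyIntegrable.locallyIntegrableOn _) ?_
    intro g hg hc hs
    have := h g hg hc hs
    rw [h0] at this
    simpa using this.symm
  have hmem : ∀ᵐ x ∂(edgeMeasure L), x ∈ Set.Ioo 0 L := by
    unfold edgeMeasure
    rw [← Measure.restrict_congr_set (Ioo_ae_eq_Icc (μ := volume))]
    exact ae_restrict_mem measurableSet_Ioo
  refine (Lp.eq_zero_iff_ae_eq_zero).2 ?_
  filter_upwards [key, hmem] with x h1 h2
  simpa using h1 h2

/-- The graph of the Dirichlet Laplacian: the pairs `(ψ, χ)` of vectors of the Hilbert space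
such that on every edge `ψ` is in `H²`, vanishes at both ends, and has second weak derivative
`χ`. -/
noncomputable def laplacianGraph : Submodule ℂ (GraphSpace × GraphSpace) where
  carrier := {p | ∀ n, IsDirichletSecondDeriv (p.1 n) (p.2 n)}
  zero_mem' := fun _ =>
    ⟨⟨0, hasWeakDeriv_zero, hasWeakDeriv_zero⟩,
      ⟨fun _ => 0, continuousOn_const, Lp.coeFn_zero ℂ 2 _, rfl, rfl⟩⟩
  add_mem' := by
    intro p q hp hq n
    obtain ⟨⟨v, hv1, hv2⟩, f, hf, hpf, hf0, hfL⟩ := hp n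
    obtain ⟨⟨w, hw1, hw2⟩, g, hg, hqg, hg0, hgL⟩ := hq n
    refine ⟨⟨v + w, hv1.add hw1, hv2.add hw2⟩, fun x => f x + g x, hf.add hg, ?_, ?_, ?_⟩
    · filter_upwards [Lp.coeFn_add (p.1 n) (q.1 n), hpf, hqg] with x h1 h2 h3
      simpa [h2, h3] using h1
    · simp [hf0, hg0]
    · simp [hfL, hgL]
  smul_mem' := by
    intro c p hp n
    obtain ⟨⟨v, hv1, hv2⟩, f, hf, hpf, hf0, hfL⟩ := hp n
    refine ⟨⟨c • v, hv1.smul c, hv2.smul c⟩, fun x => c • f x, hf.const_smul c, ?_, ?_, ?_⟩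
    · filter_upwards [Lp.coeFn_smul c (p.1 n), hpf] with x h1 h2
      simpa [h2] using h1
    · simp [hf0]
    · simp [hfL]

theorem laplacianGraph_snd_eq_zero (p : GraphSpace × GraphSpace) (hp : p ∈ laplacianGraph)
    (h : p.1 = 0) : p.2 = 0 := by
  refine lp.ext ?_
  funext n
  obtain ⟨⟨v, hv1, hv2⟩, -⟩ := hp n
  rw [h] at hv1
  have hv : v = 0 := HasWeakDeriv.eq_zero hv1
  rw [hv] at hv2
  exact hv2.eq_zero

/-- The Laplacian of the infinite quantum graph with Dirichlet conditions at all interval ends,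
an unbounded operator. -/
noncomputable def laplacian : GraphSpace →ₗ.[ℂ] GraphSpace := laplacianGraph.toLinearPMap

/-- `laplacianGraph` is the graph of a function, namely of `laplacian`. -/
theorem laplacian_graph : laplacian.graph = laplacianGraph :=
  laplacianGraph.toLinearPMap_graph_eq laplacianGraph_snd_eq_zero

/-- The multiplicity of `μ` as an eigenvalue of an unbounded operator `A`: the dimension of the
space of all `ψ` in the domain of `A` with `A ψ = μ ψ`. -/
noncomputable def multiplicity {H : Type*} [AddCommGroup H] [Module ℂ H] (A : H →ₗ.[ℂ] H)
    (μ : ℂ) : ℕ :=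
  Module.finrank ℂ (LinearMap.ker (A.toFun - μ • A.domain.subtype))

/-- The term of `tr (-Δ + k²)^{-s}` contributed by `μ`: the eigenvalue `(μ + k²)^{-s}` (principal
branch) of `(-Δ + k²)^{-s}`, counted with the multiplicity of `μ` as an eigenvalue of `-Δ`. -/
noncomputable def zetaTerm (s k μ : ℂ) : ℂ :=
  (multiplicity (-laplacian) μ : ℂ) * (μ + k ^ 2) ^ (-s)

/-- The generalized spectral zeta function `ζ_Δ(s, k) = tr (-Δ + k²)^{-s}`, the sum over all
eigenvalues of `-Δ` with multiplicity; used where this sum converges, `Re s > 1/2`. -/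
noncomputable def spectralZeta (s k : ℂ) : ℂ := ∑' μ : ℂ, zetaTerm s k μ

/-- `Z` is a meromorphic continuation of `s ↦ ζ_Δ(s, k)` to the whole plane, regular at `0`. -/
def IsZetaContinuation (k : ℂ) (Z : ℂ → ℂ) : Prop :=
  Meromorphic Z ∧ AnalyticAt ℂ Z 0 ∧ ∀ s : ℂ, 1 / 2 < s.re → Z s = spectralZeta s k

open Classical in
/-- The zeta-regularized determinant `det (-Δ + k²) = exp (-∂ₛ ζ_Δ(s, k) |_{s = 0})`, formed with
a meromorphic continuation of `ζ_Δ(·, k)` (by convention `0` if there is none). -/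
noncomputable def zetaDet (k : ℂ) : ℂ :=
  if h : ∃ Z, IsZetaContinuation k Z then Complex.exp (-deriv h.choose 0) else 0

/-- The region `K` of parameters `k` with `|Im k| < √(1 + (Re k)²)`. -/
def regionK : Set ℂ := {k | |k.im| < Real.sqrt (1 + k.re ^ 2)}

/-- The factor `(1 + w / n²)^{d(n)}`, where `d(n)` is the number of divisors of `n`. -/
noncomputable def weierstrassFactor (w : ℂ) (n : ℕ+) : ℂ :=
  (1 + w / (n : ℂ) ^ 2) ^ (n : ℕ).divisors.card

/-- The Weierstrass product `D(w) = (1 / 2π) ∏ₙ (1 + w / n²)^{d(n)}`. -/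
noncomputable def weierstrassProduct (w : ℂ) : ℂ :=
  1 / (2 * (Real.pi : ℂ)) * ∏' n : ℕ+, weierstrassFactor w n

end QuantumGraph

/-! Spectrum. On the edge of length π/n a Dirichlet solution of -u'' = κ²u is a multiple of sin(κx),
and sin(κπ/n) = 0 forces κ to be an integer multiple of n. So the eigenvalues are N², with one
eigenvector sin(Nx) for every edge n dividing N, and the multiplicity is d(N) (`multiplicity_sq`).
Weak solutions are first shown to be classical by du Bois-Reymond's lemma.

Continuation. Put w = k²; then k ∈ K says Re w > -1, so every 1 + w/n² lies in the right half plane.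
Expanding (1 + w/n²)^(-s) to J binomial terms in ∑ d(n) n^(-2s) (1 + w/n²)^(-s) gives terms with
ζ(2s+2j)², because ∑ d(n) n^(-z) = ζ(z)², and a remainder series that converges for Re s > 1/2 - J
(`norm_remainderTerm_le`). Letting J grow covers the plane; the identity theorem makes the germ at 0
unique.

Determinant. At s = 0 the case J = 1 suffices: the continuation is ζ(2s)² + ∑ d(n) n^(-2s) ((1 +
w/n²)^(-s) - 1). Its derivative is 4ζ(0)ζ'(0) - ∑ d(n) log(1 + w/n²), and 4ζ(0)ζ'(0) = log 2π
(`hasSum_log_deriv_zetaContinuation`). Exponentiating gives the product, which is entire in w since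
∑ d(n)/n² converges. -/

namespace QuantumGraph

/-! ### The Dirichlet series of the divisor function -/

section DivisorSeries

open ArithmeticFunction
open scoped ArithmeticFunction.zeta ArithmeticFunction.sigma

theorem sigma_zero_eq_zeta_mul_zeta :
    ((σ 0 : ArithmeticFunction ℕ) : ArithmeticFunction ℂ) =
      ((ζ : ArithmeticFunction ℕ) : ArithmeticFunction ℂ) *
        ((ζ : ArithmeticFunction ℕ) : ArithmeticFunction ℂ) := by
  rw [← natCoe_mul, ← zeta_mul_pow_eq_sigma, pow_zero_eq_zeta]

/-- The divisor function is the Dirichlet convolution 1 * 1, so its Dirichlet series is the square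
of that of 1. -/
theorem hasSum_divisors_mul_cpow {s : ℂ} (hs : 1 < s.re) :
    HasSum (fun n : ℕ+ => ((n : ℕ).divisors.card : ℂ) * (n : ℂ) ^ (-s)) (riemannZeta s ^ 2) := by
  have hz : LSeriesSummable
      (fun n => ((ζ : ArithmeticFunction ℕ) : ArithmeticFunction ℂ) n) s := by
    simpa using LSeriesSummable_zeta_iff.2 hs
  have h := (LSeriesSummable_mul hz hz).LSeriesHasSum
  rw [LSeries_mul' hz hz] at h
  have hL : LSeries (fun n => ((ζ : ArithmeticFunction ℕ) : ArithmeticFunction ℂ) n) s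
      = riemannZeta s := by
    simpa using LSeries_zeta_eq_riemannZeta hs
  rw [hL, ← sigma_zero_eq_zeta_mul_zeta, ← sq, LSeriesHasSum] at h
  -- `LSeries.term` is 0 at index 0 by convention, so passing from ℕ to ℕ+ loses nothing.
  have hsupp : Function.support (LSeries.term
      (fun n => ((σ 0 : ArithmeticFunction ℕ) : ArithmeticFunction ℂ) n) s) ⊆
        Set.range (fun n : ℕ+ => (n : ℕ)) := by
    intro n hn
    have : n ≠ 0 := by
      rintro rfl
      simp at hn
    exact ⟨⟨n, Nat.pos_of_ne_zero this⟩, rfl⟩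
  rw [← PNat.coe_injective.hasSum_iff (f := LSeries.term _ s)
    (fun n hn => by_contra fun h0 => hn (hsupp h0))] at h
  refine h.congr_fun ?_
  intro n
  simp [sigma_zero_apply, Complex.cpow_neg, div_eq_mul_inv]

theorem summable_divisors_mul_rpow {x : ℝ} (hx : 1 < x) :
    Summable (fun n : ℕ+ => ((n : ℕ).divisors.card : ℝ) * (n : ℝ) ^ (-x)) := by
  have h := (hasSum_divisors_mul_cpow (s := x) (by simpa using hx)).summable.norm
  refine h.congr fun n => ?_
  have hn : (0 : ℝ) < (n : ℕ) := by exact_mod_cast n.pos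
  rw [norm_mul, Complex.norm_natCast, Complex.norm_natCast_cpow_of_pos n.pos]
  simp

end DivisorSeries

/-! ### The binomial expansion of `(1 + w) ^ (-s)` with remainder -/

/-- The binomial coefficient of `-s` over `j`, the coefficient of `w ^ j` in `(1 + w) ^ (-s)`. -/
noncomputable def binomCoeff : ℕ → ℂ → ℂ
  | 0, _ => 1
  | j + 1, s => -s / (j + 1) * binomCoeff j (s + 1)

/-- The remainder of the binomial expansion of `(1 + w) ^ (-s)` after `J` terms. -/
noncomputable def binomRemainder (J : ℕ) (s w : ℂ) : ℂ :=
  (1 + w) ^ (-s) - ∑ j ∈ Finset.range J, binomCoeff j s * w ^ j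

theorem differentiable_binomCoeff (j : ℕ) : Differentiable ℂ (binomCoeff j) := by
  induction j with
  | zero => exact differentiable_const _
  | succ j ih =>
    have : binomCoeff (j + 1) = fun s => -s / (j + 1) * binomCoeff j (s + 1) := rfl
    rw [this]
    have h2 : Differentiable ℂ fun s => binomCoeff j (s + 1) :=
      ih.comp (differentiable_id.add_const 1)
    fun_prop

theorem binomRemainder_succ (J : ℕ) (s w : ℂ) :
    binomRemainder J s w = binomCoeff J s * w ^ J + binomRemainder (J + 1) s w := by
  simp only [binomRemainder, Finset.sum_range_succ]
  ring

/-- Differentiation in w lowers the order by one and shifts s to s + 1. The recursion in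
`binomCoeff` is chosen to match this, which makes induction on J possible. -/
theorem hasDerivAt_binomRemainder (J : ℕ) (s : ℂ) {w : ℂ} (hw : 1 + w ∈ Complex.slitPlane) :
    HasDerivAt (binomRemainder (J + 1) s) (-s * binomRemainder J (s + 1) w) w := by
  have h1 : HasDerivAt (fun w : ℂ => (1 + w) ^ (-s)) (-s * (1 + w) ^ (-s - 1) * 1) w :=
    HasDerivAt.cpow_const ((hasDerivAt_id w).const_add 1) hw
  have h2 : HasDerivAt (fun w : ℂ => ∑ j ∈ Finset.range (J + 1), binomCoeff j s * w ^ j)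
      (∑ j ∈ Finset.range (J + 1), binomCoeff j s * ((j : ℂ) * w ^ (j - 1))) w :=
    HasDerivAt.fun_sum fun j _ => (hasDerivAt_pow j w).const_mul _
  refine (h1.sub h2).congr_deriv ?_
  rw [Finset.sum_range_succ', binomRemainder, mul_sub, Finset.mul_sum]
  congr 1
  · rw [mul_one, neg_add, sub_eq_add_neg]
  · simp only [Nat.cast_zero, zero_mul, mul_zero, add_zero]
    refine Finset.sum_congr rfl fun j _ => ?_
    have : ((j : ℂ) + 1) ≠ 0 := by exact_mod_cast Nat.succ_ne_zero j
    simp only [binomCoeff, Nat.cast_add, Nat.cast_one, Nat.add_sub_cancel]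
    field_simp

theorem binomRemainder_succ_zero (J : ℕ) (s : ℂ) : binomRemainder (J + 1) s 0 = 0 := by
  rw [binomRemainder, Finset.sum_range_succ']
  simp [binomCoeff]

theorem re_one_add_mul_pos {w : ℂ} (hw : -1 < w.re) {t : ℝ} (ht : t ∈ Set.Icc (0 : ℝ) 1) :
    0 < (1 + t * w).re := by
  have : (1 + t * w).re = 1 + t * w.re := by simp
  rw [this]
  obtain ⟨h0, h1⟩ := ht
  rcases h0.eq_or_lt with rfl | h0
  · simp
  · nlinarith [mul_pos h0 (neg_lt_iff_pos_add'.1 hw)]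

theorem one_add_mul_mem_slitPlane {w : ℂ} (hw : -1 < w.re) {t : ℝ}
    (ht : t ∈ Set.Icc (0 : ℝ) 1) : 1 + t * w ∈ Complex.slitPlane :=
  Or.inl (re_one_add_mul_pos hw ht)

/-- Since |w| may exceed 1, the binomial series itself need not converge. Instead the derivative
formula is integrated (as a mean value inequality) along the segment from 0 to tw, on which 1 + xw
stays in the right half plane. Each integration gains a factor t. -/
theorem norm_binomRemainder_le {w : ℂ} (hw : -1 < w.re) (J : ℕ) (B : ℝ) :
    ∃ C, 0 ≤ C ∧ ∀ s : ℂ, ‖s‖ ≤ B → ∀ t ∈ Set.Icc (0 : ℝ) 1,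
      ‖binomRemainder J s (t * w)‖ ≤ C * t ^ J := by
  induction J generalizing B with
  | zero =>
    have hc : ContinuousOn (fun p : ℂ × ℝ => (1 + p.2 * w) ^ (-p.1))
        (Metric.closedBall 0 B ×ˢ Set.Icc (0 : ℝ) 1) := by
      refine ContinuousOn.cpow (by fun_prop) (by fun_prop) ?_
      rintro ⟨s, t⟩ ⟨-, ht⟩
      exact one_add_mul_mem_slitPlane hw ht
    obtain ⟨C, hC⟩ := ((isCompact_closedBall (0 : ℂ) B).prod
      (isCompact_Icc (a := (0 : ℝ)) (b := 1))).exists_bound_of_continuousOn hc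
    refine ⟨max C 0, le_max_right _ _, fun s hs t ht => ?_⟩
    have := hC (s, t) ⟨by simpa using hs, ht⟩
    simpa [binomRemainder] using Or.inl this
  | succ J ih =>
    -- The derivative involves the remainder at s + 1, hence the larger ball.
    obtain ⟨C, hC0, hC⟩ := ih (B + 1)
    refine ⟨|B| * C * ‖w‖, by positivity, fun s hs t ht => ?_⟩
    have hd : ∀ x ∈ Set.Icc (0 : ℝ) t, HasDerivWithinAt
        (fun x : ℝ => binomRemainder (J + 1) s (x * w))
        (-s * binomRemainder J (s + 1) (x * w) * w) (Set.Icc (0 : ℝ) t) x := by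
      intro x hx
      have h1 : HasDerivAt (fun x : ℝ => (x : ℂ) * w) w x := by
        simpa using (Complex.ofRealCLM.hasDerivAt (x := x)).mul_const w
      exact (HasDerivAt.comp x (hasDerivAt_binomRemainder J s
        (one_add_mul_mem_slitPlane hw ⟨hx.1, hx.2.trans ht.2⟩)) h1).hasDerivWithinAt
    have hb : ∀ x ∈ Set.Icc (0 : ℝ) t,
        ‖-s * binomRemainder J (s + 1) (x * w) * w‖ ≤ |B| * (C * t ^ J) * ‖w‖ := by
      intro x hx
      have hs1 : ‖s + 1‖ ≤ B + 1 := (norm_add_le _ _).trans (by simpa using hs)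
      have h1 := hC (s + 1) hs1 x ⟨hx.1, hx.2.trans ht.2⟩
      have h2 : C * x ^ J ≤ C * t ^ J :=
        mul_le_mul_of_nonneg_left (pow_le_pow_left₀ hx.1 hx.2 J) hC0
      rw [norm_mul, norm_mul, norm_neg]
      gcongr
      · exact hs.trans (le_abs_self B)
      · exact h1.trans h2
    have := (convex_Icc (0 : ℝ) t).norm_image_sub_le_of_norm_hasDerivWithin_le hd hb
      (Set.left_mem_Icc.2 ht.1) (Set.right_mem_Icc.2 ht.1)
    simp only [Complex.ofReal_zero, zero_mul, binomRemainder_succ_zero, sub_zero,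
      Real.norm_of_nonneg ht.1] at this
    calc _ ≤ _ := this
      _ = _ := by ring

/-! ### Meromorphic continuation -/

/-- The `n`-th term of the zeta series after subtraction of `J` terms of the binomial
expansion. -/
noncomputable def remainderTerm (w : ℂ) (J : ℕ) (n : ℕ+) (s : ℂ) : ℂ :=
  ((n : ℕ).divisors.card : ℂ) * (n : ℂ) ^ (-(2 * s)) * binomRemainder J s (w / (n : ℂ) ^ 2)

/-- The continuation of `∑ d(n) (n² + w)^(-s)` to the half plane `Re s > 1/2 - J`. -/
noncomputable def partialContinuation (w : ℂ) (J : ℕ) (s : ℂ) : ℂ :=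
  ∑ j ∈ Finset.range J, binomCoeff j s * w ^ j * riemannZeta (2 * s + 2 * j) ^ 2 +
    ∑' n : ℕ+, remainderTerm w J n s

/-- The meromorphic continuation of `∑ d(n) (n² + w)^(-s)` to the plane. -/
noncomputable def zetaContinuation (w s : ℂ) : ℂ :=
  partialContinuation w (⌈|s.re|⌉₊ + 1) s

theorem inv_sq_mem_Icc (n : ℕ+) : (((n : ℕ) : ℝ) ^ 2)⁻¹ ∈ Set.Icc (0 : ℝ) 1 := by
  refine ⟨by positivity, inv_le_one_of_one_le₀ (one_le_pow₀ ?_)⟩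
  exact_mod_cast n.pos

theorem div_sq_eq (w : ℂ) (n : ℕ+) :
    w / (n : ℂ) ^ 2 = (((((n : ℕ) : ℝ) ^ 2)⁻¹ : ℝ) : ℂ) * w := by
  push_cast
  rw [div_eq_mul_inv, mul_comm]

theorem one_add_div_sq_mem_slitPlane {w : ℂ} (hw : -1 < w.re) (n : ℕ+) :
    1 + w / (n : ℂ) ^ 2 ∈ Complex.slitPlane := by
  rw [div_sq_eq]
  exact one_add_mul_mem_slitPlane hw (inv_sq_mem_Icc n)

/-- The bound along the segment, taken at t = 1/n², yields the factor n^(-2J). The extra parameter a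
makes the estimate uniform on bounded parts of a half plane. -/
theorem norm_remainderTerm_le {w : ℂ} (hw : -1 < w.re) (J : ℕ) (B : ℝ) :
    ∃ C, 0 ≤ C ∧ ∀ (n : ℕ+) (a : ℝ) (s : ℂ), ‖s‖ ≤ B → a ≤ s.re →
      ‖remainderTerm w J n s‖ ≤
        C * (((n : ℕ).divisors.card : ℝ) * (n : ℝ) ^ (-(2 * a + 2 * J))) := by
  obtain ⟨C, hC0, hC⟩ := norm_binomRemainder_le hw J B
  refine ⟨C, hC0, fun n a s hs ha => ?_⟩
  have hn : (0 : ℝ) < (n : ℕ) := by exact_mod_cast n.pos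
  have hn1 : (1 : ℝ) ≤ (n : ℕ) := by exact_mod_cast n.pos
  have h1 := hC s hs _ (inv_sq_mem_Icc n)
  rw [← div_sq_eq] at h1
  have h2 : ((((n : ℕ) : ℝ) ^ 2)⁻¹) ^ J = ((n : ℕ) : ℝ) ^ (-(2 * J : ℝ)) := by
    rw [Real.rpow_neg hn.le, inv_pow, ← pow_mul, ← Real.rpow_natCast]
    push_cast
    rfl
  rw [h2] at h1
  have h3 : ((n : ℕ) : ℝ) ^ (-(2 * s)).re ≤ ((n : ℕ) : ℝ) ^ (-(2 * a)) :=
    Real.rpow_le_rpow_of_exponent_le hn1 (by simpa using ha)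
  rw [remainderTerm, norm_mul, norm_mul, Complex.norm_natCast,
    Complex.norm_natCast_cpow_of_pos n.pos]
  calc ((n : ℕ).divisors.card : ℝ) * ((n : ℕ) : ℝ) ^ (-(2 * s)).re *
        ‖binomRemainder J s (w / (n : ℂ) ^ 2)‖
      ≤ ((n : ℕ).divisors.card : ℝ) * ((n : ℕ) : ℝ) ^ (-(2 * a)) *
          (C * ((n : ℕ) : ℝ) ^ (-(2 * J : ℝ))) := by gcongr
    _ = C * (((n : ℕ).divisors.card : ℝ) *
          (((n : ℕ) : ℝ) ^ (-(2 * a)) * ((n : ℕ) : ℝ) ^ (-(2 * J : ℝ)))) := by ring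
    _ = _ := by rw [← Real.rpow_add hn]; congr 3; ring

theorem summable_remainderTerm {w : ℂ} (hw : -1 < w.re) (J : ℕ) {s : ℂ}
    (hs : 1 / 2 - (J : ℝ) < s.re) : Summable (fun n => remainderTerm w J n s) := by
  obtain ⟨C, -, hC⟩ := norm_remainderTerm_le hw J ‖s‖
  refine Summable.of_norm_bounded
    ((summable_divisors_mul_rpow (x := 2 * s.re + 2 * J) (by linarith)).mul_left C) fun n => ?_
  exact hC n _ s le_rfl le_rfl

theorem differentiable_remainderTerm {w : ℂ} (hw : -1 < w.re) (J : ℕ) (n : ℕ+) :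
    Differentiable ℂ (remainderTerm w J n) := by
  have hn : (n : ℂ) ≠ 0 := by exact_mod_cast n.ne_zero
  have h1 : 1 + w / (n : ℂ) ^ 2 ≠ 0 :=
    Complex.slitPlane_ne_zero (one_add_div_sq_mem_slitPlane hw n)
  have h2 := fun j => differentiable_binomCoeff j
  have h3 : Differentiable ℂ fun s : ℂ => (n : ℂ) ^ (-(2 * s)) := fun s =>
    DifferentiableAt.const_cpow (by fun_prop) (Or.inl hn)
  have h4 : Differentiable ℂ fun s : ℂ => (1 + w / (n : ℂ) ^ 2) ^ (-s) := fun s =>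
    DifferentiableAt.const_cpow (by fun_prop) (Or.inl h1)
  unfold remainderTerm binomRemainder
  fun_prop

/-- Near every point of the half plane the remainder terms have a summable bound. -/
theorem exists_summable_bound {w : ℂ} (hw : -1 < w.re) (J : ℕ) {s₀ : ℂ}
    (hs : 1 / 2 - (J : ℝ) < s₀.re) :
    ∃ (U : Set ℂ) (u : ℕ+ → ℝ), IsOpen U ∧ s₀ ∈ U ∧ Summable u ∧
      ∀ n, ∀ s ∈ U, ‖remainderTerm w J n s‖ ≤ u n := by
  obtain ⟨a, ha1, ha2⟩ := exists_between hs
  obtain ⟨C, -, hC⟩ := norm_remainderTerm_le hw J (‖s₀‖ + 1)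
  refine ⟨Metric.ball s₀ 1 ∩ {s | a < s.re}, _,
    Metric.isOpen_ball.inter (isOpen_lt continuous_const Complex.continuous_re),
    ⟨Metric.mem_ball_self one_pos, ha2⟩,
    (summable_divisors_mul_rpow (x := 2 * a + 2 * J) (by linarith)).mul_left C, ?_⟩
  rintro n s ⟨hs1, hs2⟩
  refine hC n a s ?_ (le_of_lt hs2)
  have h1 := norm_le_norm_add_norm_sub' s s₀
  rw [Metric.mem_ball, dist_eq_norm] at hs1
  linarith

theorem analyticAt_tsum_remainderTerm {w : ℂ} (hw : -1 < w.re) (J : ℕ) {s : ℂ}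
    (hs : 1 / 2 - (J : ℝ) < s.re) :
    AnalyticAt ℂ (fun s => ∑' n : ℕ+, remainderTerm w J n s) s := by
  obtain ⟨U, u, hU, hsU, hu, hb⟩ := exists_summable_bound hw J hs
  exact (Complex.differentiableOn_tsum_of_summable_norm hu
    (fun n => (differentiable_remainderTerm hw J n).differentiableOn) hU hb).analyticAt
    (hU.mem_nhds hsU)

theorem analyticAt_riemannZeta {s : ℂ} (hs : s ≠ 1) : AnalyticAt ℂ riemannZeta s :=
  differentiableOn_riemannZeta.analyticAt (isOpen_compl_singleton.mem_nhds hs)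

theorem meromorphicAt_riemannZeta (s : ℂ) : MeromorphicAt riemannZeta s := by
  rcases eq_or_ne s 1 with rfl | hs
  · have h1 : MeromorphicAt (fun s : ℂ => (s - 1)⁻¹ + riemannZeta₀ s) 1 :=
      ((MeromorphicAt.id 1).sub (MeromorphicAt.const 1 1)).inv.add
        (differentiable_riemannZeta₀.analyticAt 1).meromorphicAt
    refine h1.congr ?_
    filter_upwards [self_mem_nhdsWithin] with z hz
    exact (riemannZeta_eq_inv_sub_add hz).symm
  · exact (analyticAt_riemannZeta hs).meromorphicAt

theorem meromorphicAt_partialContinuation {w : ℂ} (hw : -1 < w.re) (J : ℕ) {s : ℂ}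
    (hs : 1 / 2 - (J : ℝ) < s.re) : MeromorphicAt (partialContinuation w J) s := by
  refine MeromorphicAt.add ?_ (analyticAt_tsum_remainderTerm hw J hs).meromorphicAt
  refine MeromorphicAt.fun_sum fun j _ => ?_
  refine MeromorphicAt.mul ?_ (MeromorphicAt.pow ?_ 2)
  · exact (((differentiable_binomCoeff j).mul_const _).analyticAt s).meromorphicAt
  · have hg : AnalyticAt ℂ (fun s : ℂ => 2 * s + 2 * j) s :=
      Differentiable.analyticAt (by fun_prop) s
    exact MeromorphicAt.comp_analyticAt (meromorphicAt_riemannZeta _) hg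

/-- One binomial term moves from the remainder series to the zeta sum; its series converges because
Re s > 1/2 - J means Re(2s + 2J) > 1. -/
theorem partialContinuation_succ {w : ℂ} (hw : -1 < w.re) (J : ℕ) {s : ℂ}
    (hs : 1 / 2 - (J : ℝ) < s.re) :
    partialContinuation w (J + 1) s = partialContinuation w J s := by
  have hre : 1 < (2 * s + 2 * J : ℂ).re := by
    have : (2 * s + 2 * J : ℂ).re = 2 * s.re + 2 * J := by simp
    rw [this]; linarith
  have hz := (hasSum_divisors_mul_cpow hre).mul_left (binomCoeff J s * w ^ J)
  have ht : ∀ n : ℕ+, remainderTerm w J n s = binomCoeff J s * w ^ J *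
      (((n : ℕ).divisors.card : ℂ) * (n : ℂ) ^ (-(2 * s + 2 * J : ℂ))) +
        remainderTerm w (J + 1) n s := by
    intro n
    have hn : (n : ℂ) ≠ 0 := by exact_mod_cast n.ne_zero
    have h1 : (n : ℂ) ^ (-(2 * s + 2 * J : ℂ)) = (n : ℂ) ^ (-(2 * s)) / ((n : ℂ) ^ 2) ^ J := by
      rw [neg_add, ← sub_eq_add_neg, Complex.cpow_sub _ _ hn, ← pow_mul]
      congr 1
      exact_mod_cast Complex.cpow_natCast (n : ℂ) (2 * J)
    rw [h1, remainderTerm, remainderTerm, binomRemainder_succ, div_pow]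
    ring
  have hs' : 1 / 2 - ((J + 1 : ℕ) : ℝ) < s.re := by push_cast; linarith
  rw [partialContinuation, partialContinuation, Finset.sum_range_succ]
  simp_rw [ht]
  rw [hz.summable.tsum_add (summable_remainderTerm hw (J + 1) hs'), hz.tsum_eq]
  ring

theorem partialContinuation_eq_of_le {w : ℂ} (hw : -1 < w.re) {J J' : ℕ} (hJ : J ≤ J') {s : ℂ}
    (hs : 1 / 2 - (J : ℝ) < s.re) :
    partialContinuation w J' s = partialContinuation w J s := by
  induction J', hJ using Nat.le_induction with
  | base => rfl
  | succ m hm ih =>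
    rw [partialContinuation_succ hw m, ih]
    have : (J : ℝ) ≤ m := by exact_mod_cast hm
    linarith

/-- The number of terms in `zetaContinuation` jumps with s; comparison with a fixed J is what gives
local regularity. -/
theorem zetaContinuation_eq {w : ℂ} (hw : -1 < w.re) {J : ℕ} {s : ℂ}
    (hs : 1 / 2 - (J : ℝ) < s.re) : zetaContinuation w s = partialContinuation w J s := by
  have h1 : 1 / 2 - ((⌈|s.re|⌉₊ + 1 : ℕ) : ℝ) < s.re := by
    have := Nat.le_ceil |s.re|
    have := neg_abs_le s.re
    push_cast
    linarith
  rcases le_total J (⌈|s.re|⌉₊ + 1) with h | h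
  · exact partialContinuation_eq_of_le hw h hs
  · exact (partialContinuation_eq_of_le hw h h1).symm

theorem zetaContinuation_eventuallyEq {w : ℂ} (hw : -1 < w.re) {J : ℕ} {s : ℂ}
    (hs : 1 / 2 - (J : ℝ) < s.re) :
    zetaContinuation w =ᶠ[nhds s] partialContinuation w J := by
  filter_upwards [(isOpen_lt continuous_const Complex.continuous_re).mem_nhds hs] with z hz
  exact zetaContinuation_eq hw hz

theorem meromorphic_zetaContinuation {w : ℂ} (hw : -1 < w.re) :
    Meromorphic (zetaContinuation w) := by
  intro s
  obtain ⟨J, hJ⟩ := exists_nat_gt (1 / 2 - s.re)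
  have hs : 1 / 2 - (J : ℝ) < s.re := by linarith
  exact (meromorphicAt_partialContinuation hw J hs).congr
    ((zetaContinuation_eventuallyEq hw hs).symm.filter_mono nhdsWithin_le_nhds)

/-- As n² is a positive real, log(n²z) = 2 log n + log z on the principal branch, with no 2πi
correction. -/
theorem sq_add_cpow_neg {w : ℂ} (hw : -1 < w.re) (n : ℕ+) (s : ℂ) :
    ((n : ℂ) ^ 2 + w) ^ (-s) = (n : ℂ) ^ (-(2 * s)) * (1 + w / (n : ℂ) ^ 2) ^ (-s) := by
  have hn : (0 : ℝ) < (n : ℕ) := by exact_mod_cast n.pos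
  have hn' : (n : ℂ) ≠ 0 := by exact_mod_cast n.ne_zero
  have h1 : 1 + w / (n : ℂ) ^ 2 ≠ 0 :=
    Complex.slitPlane_ne_zero (one_add_div_sq_mem_slitPlane hw n)
  have h2 : (n : ℂ) ^ 2 + w = ((((n : ℕ) : ℝ) ^ 2 : ℝ) : ℂ) * (1 + w / (n : ℂ) ^ 2) := by
    push_cast
    field_simp
  have h3 : ((((n : ℕ) : ℝ) ^ 2 : ℝ) : ℂ) ≠ 0 := by
    push_cast
    exact pow_ne_zero 2 hn'
  rw [h2, Complex.cpow_def_of_ne_zero (mul_ne_zero h3 h1), Complex.log_ofReal_mul (by positivity) h1,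
    Complex.cpow_def_of_ne_zero hn', Complex.cpow_def_of_ne_zero h1, ← Complex.exp_add,
    Real.log_pow, ← Complex.natCast_log]
  congr 1
  push_cast
  ring

theorem remainderTerm_zero {w : ℂ} (hw : -1 < w.re) (n : ℕ+) (s : ℂ) :
    remainderTerm w 0 n s = ((n : ℕ).divisors.card : ℂ) * ((n : ℂ) ^ 2 + w) ^ (-s) := by
  rw [sq_add_cpow_neg hw, remainderTerm, binomRemainder]
  simp [mul_assoc]

theorem hasSum_zetaContinuation {w : ℂ} (hw : -1 < w.re) {s : ℂ} (hs : 1 / 2 < s.re) :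
    HasSum (fun n : ℕ+ => ((n : ℕ).divisors.card : ℂ) * ((n : ℂ) ^ 2 + w) ^ (-s))
      (zetaContinuation w s) := by
  have hs' : 1 / 2 - ((0 : ℕ) : ℝ) < s.re := by simpa using hs
  rw [zetaContinuation_eq hw hs', partialContinuation]
  simp_rw [← remainderTerm_zero hw]
  simpa using (summable_remainderTerm hw 0 hs').hasSum

/-- With J = 1 the only possible pole comes from ζ(2s)², at s = 1/2. -/
theorem analyticAt_zetaContinuation_zero {w : ℂ} (hw : -1 < w.re) :
    AnalyticAt ℂ (zetaContinuation w) 0 := by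
  have hs : 1 / 2 - ((1 : ℕ) : ℝ) < (0 : ℂ).re := by norm_num
  refine AnalyticAt.congr ?_ (zetaContinuation_eventuallyEq hw hs).symm
  refine AnalyticAt.add ?_ (analyticAt_tsum_remainderTerm hw 1 hs)
  simp only [Finset.range_one, Finset.sum_singleton, binomCoeff, pow_zero, one_mul,
    Nat.cast_zero, mul_zero, add_zero]
  have hg : AnalyticAt ℂ (fun s : ℂ => 2 * s) 0 := Differentiable.analyticAt (by fun_prop) 0
  have hz : AnalyticAt ℂ riemannZeta (2 * 0) := analyticAt_riemannZeta (by norm_num)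
  exact (AnalyticAt.fun_comp (f := fun s : ℂ => 2 * s) hz hg).pow 2

theorem hasDerivAt_remainderTerm_one_zero {w : ℂ} (hw : -1 < w.re) (n : ℕ+) :
    HasDerivAt (remainderTerm w 1 n)
      (-(((n : ℕ).divisors.card : ℂ) * Complex.log (1 + w / (n : ℂ) ^ 2))) 0 := by
  have hn : (n : ℂ) ≠ 0 := by exact_mod_cast n.ne_zero
  have h1 : 1 + w / (n : ℂ) ^ 2 ≠ 0 :=
    Complex.slitPlane_ne_zero (one_add_div_sq_mem_slitPlane hw n)
  have e : remainderTerm w 1 n = fun s => ((n : ℕ).divisors.card : ℂ) * (n : ℂ) ^ (-(2 * s)) *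
      ((1 + w / (n : ℂ) ^ 2) ^ (-s) - 1) := by
    funext s
    simp [remainderTerm, binomRemainder, binomCoeff]
  have h3 : HasDerivAt (fun s : ℂ => (n : ℂ) ^ (-(2 * s))) _ 0 :=
    HasDerivAt.const_cpow (((hasDerivAt_id (0 : ℂ)).const_mul 2).neg) (Or.inl hn)
  have h4 : HasDerivAt (fun s : ℂ => (1 + w / (n : ℂ) ^ 2) ^ (-s)) _ 0 :=
    HasDerivAt.const_cpow (hasDerivAt_id (0 : ℂ)).neg (Or.inl h1)
  rw [e]
  -- The last factor vanishes at s = 0, so the derivative of n^(-2s) drops out.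
  refine ((h3.const_mul ((n : ℕ).divisors.card : ℂ)).mul (h4.sub_const 1)).congr_deriv ?_
  simp

theorem hasSum_log_deriv_zetaContinuation {w : ℂ} (hw : -1 < w.re) :
    HasSum (fun n : ℕ+ => ((n : ℕ).divisors.card : ℂ) * Complex.log (1 + w / (n : ℂ) ^ 2))
      (Complex.log (2 * Real.pi) - deriv (zetaContinuation w) 0) := by
  have hs : 1 / 2 - ((1 : ℕ) : ℝ) < (0 : ℂ).re := by norm_num
  obtain ⟨U, u, hU, hsU, hu, hb⟩ := exists_summable_bound hw 1 hs
  have h1 := Complex.hasSum_deriv_of_summable_norm hu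
    (fun n => (differentiable_remainderTerm hw 1 n).differentiableOn) hU hb hsU
  simp_rw [fun n => (hasDerivAt_remainderTerm_one_zero hw n).deriv] at h1
  have h2 : HasDerivAt (fun s : ℂ => riemannZeta (2 * s) ^ 2) (Complex.log (2 * Real.pi)) 0 := by
    have hz : HasDerivAt riemannZeta (-Complex.log (2 * Real.pi) / 2) (2 * 0) := by
      rw [mul_zero, ← deriv_riemannZeta_zero]
      exact (differentiableAt_riemannZeta (by norm_num)).hasDerivAt
    have := (HasDerivAt.comp (0 : ℂ) hz ((hasDerivAt_id (0 : ℂ)).const_mul 2)).pow 2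
    refine this.congr_deriv ?_
    -- 2ζ(0) · 2ζ'(0) with ζ(0) = -1/2 and ζ'(0) = -log(2π)/2.
    simp [riemannZeta_zero]
    ring
  have h3 : deriv (zetaContinuation w) 0 = Complex.log (2 * Real.pi) +
      deriv (fun s => ∑' n : ℕ+, remainderTerm w 1 n s) 0 := by
    rw [(zetaContinuation_eventuallyEq hw hs).deriv_eq]
    have e : partialContinuation w 1 = fun s => riemannZeta (2 * s) ^ 2 +
        ∑' n : ℕ+, remainderTerm w 1 n s := by
      funext s
      simp [partialContinuation, binomCoeff]
    rw [e]
    exact (h2.add (analyticAt_tsum_remainderTerm hw 1 hs).differentiableAt.hasDerivAt).deriv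
  rw [h3]
  simpa using h1.neg

/-! ### Uniqueness of the continuation and the determinant -/

/-- Identity theorem: on the connected plane the order of f - g is infinite at every point or at
none. Analyticity at a then upgrades equality on a punctured neighbourhood to a full one, as `deriv`
at a requires. -/
theorem _root_.Meromorphic.eventuallyEq_of_eventuallyEq {f g : ℂ → ℂ} (hf : Meromorphic f)
    (hg : Meromorphic g) {a b : ℂ} (ha : AnalyticAt ℂ f a) (hga : AnalyticAt ℂ g a)
    (hb : f =ᶠ[nhds b] g) : f =ᶠ[nhds a] g := by
  have hm : Meromorphic (f - g) := fun x => (hf x).sub (hg x)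
  have hbt : meromorphicOrderAt (f - g) b = ⊤ := by
    rw [meromorphicOrderAt_eq_top_iff]
    filter_upwards [hb.filter_mono nhdsWithin_le_nhds] with z hz
    simp [hz]
  have hat : meromorphicOrderAt (f - g) a = ⊤ := by
    by_contra h
    exact hm.exists_meromorphicOrderAt_ne_top_iff_forall.1 ⟨a, h⟩ b hbt
  rw [meromorphicOrderAt_eq_top_iff] at hat
  have h2 := (ha.sub hga).frequently_zero_iff_eventually_zero.1 hat.frequently
  filter_upwards [h2] with z hz
  exact sub_eq_zero.1 hz

theorem IsZetaContinuation.deriv_eq {k : ℂ} {Z₁ Z₂ : ℂ → ℂ} (h₁ : IsZetaContinuation k Z₁)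
    (h₂ : IsZetaContinuation k Z₂) : deriv Z₁ 0 = deriv Z₂ 0 := by
  refine Filter.EventuallyEq.deriv_eq
    (h₁.1.eventuallyEq_of_eventuallyEq h₂.1 (b := 1) h₁.2.1 h₂.2.1 ?_)
  have h : (1 / 2 : ℝ) < (1 : ℂ).re := by norm_num
  filter_upwards [(isOpen_lt continuous_const Complex.continuous_re).mem_nhds h] with z hz
  rw [h₁.2.2 z hz, h₂.2.2 z hz]

theorem IsZetaContinuation.zetaDet_eq {k : ℂ} {Z : ℂ → ℂ} (hZ : IsZetaContinuation k Z) :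
    zetaDet k = Complex.exp (-deriv Z 0) := by
  have h : ∃ Z, IsZetaContinuation k Z := ⟨Z, hZ⟩
  rw [zetaDet, dif_pos h, h.choose_spec.deriv_eq hZ]

/-! ### The Weierstrass product -/

theorem hasProd_weierstrassFactor {w : ℂ} (hw : -1 < w.re) :
    HasProd (weierstrassFactor w)
      (2 * Real.pi * Complex.exp (-deriv (zetaContinuation w) 0)) := by
  have h := (hasSum_log_deriv_zetaContinuation hw).cexp
  have hpi : (2 * Real.pi : ℂ) ≠ 0 := by exact_mod_cast Real.two_pi_pos.ne'
  rw [sub_eq_add_neg, Complex.exp_add, Complex.exp_log hpi] at h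
  refine h.congr_fun fun n => ?_
  rw [Function.comp_apply, weierstrassFactor, Complex.exp_nat_mul,
    Complex.exp_log (Complex.slitPlane_ne_zero (one_add_div_sq_mem_slitPlane hw n))]

theorem norm_one_add_pow_sub_one_le (z : ℂ) (m : ℕ) :
    ‖(1 + z) ^ m - 1‖ ≤ (1 + ‖z‖) ^ m - 1 := by
  induction m with
  | zero => simp
  | succ m ih =>
    have e : (1 + z) ^ (m + 1) - 1 = ((1 + z) ^ m - 1) * (1 + z) + z := by ring
    rw [e]
    calc _ ≤ ‖(1 + z) ^ m - 1‖ * ‖1 + z‖ + ‖z‖ := (norm_add_le _ _).trans (by rw [norm_mul])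
      _ ≤ ((1 + ‖z‖) ^ m - 1) * (1 + ‖z‖) + ‖z‖ := by
        gcongr
        · exact (norm_nonneg _).trans ih
        · exact (norm_add_le _ _).trans (by simp)
      _ = _ := by ring

theorem summable_divisors_div_sq :
    Summable (fun n : ℕ+ => ((n : ℕ).divisors.card : ℝ) / (n : ℝ) ^ 2) := by
  refine (summable_divisors_mul_rpow (x := 2) (by norm_num)).congr fun n => ?_
  have hn : (0 : ℝ) < (n : ℕ) := by exact_mod_cast n.pos
  rw [Real.rpow_neg hn.le, div_eq_mul_inv]
  norm_num

/-- With x = |R| d(n)/n², the factor differs from 1 by at most e^x - 1 ≤ x e^x, and e^x is bounded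
by the exponential of the whole sum. This feeds the M-test for products. -/
theorem norm_weierstrassFactor_sub_one_le (R : ℝ) : ∃ u : ℕ+ → ℝ, Summable u ∧
    ∀ n w, ‖w‖ ≤ R → ‖weierstrassFactor w n - 1‖ ≤ u n := by
  set x : ℕ+ → ℝ := fun n => |R| * (((n : ℕ).divisors.card : ℝ) / (n : ℝ) ^ 2) with hx
  have hxs : Summable x := summable_divisors_div_sq.mul_left _
  have hx0 : ∀ n, 0 ≤ x n := fun n => by positivity
  refine ⟨fun n => x n * Real.exp (∑' n, x n), hxs.mul_right _, fun n w hw => ?_⟩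
  have hxn : x n ≤ ∑' n, x n := hxs.le_tsum n fun m _ => hx0 m
  have h1 := norm_one_add_pow_sub_one_le (w / (n : ℂ) ^ 2) (n : ℕ).divisors.card
  have h2 : ‖w / (n : ℂ) ^ 2‖ ≤ |R| / (n : ℝ) ^ 2 := by
    rw [norm_div, norm_pow, Complex.norm_natCast]
    gcongr
    exact hw.trans (le_abs_self R)
  have h3 : (1 + ‖w / (n : ℂ) ^ 2‖) ^ (n : ℕ).divisors.card ≤ Real.exp (x n) := by
    calc _ ≤ (Real.exp (|R| / (n : ℝ) ^ 2)) ^ (n : ℕ).divisors.card := by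
          gcongr
          have := Real.add_one_le_exp (|R| / (n : ℝ) ^ 2)
          linarith
      _ = Real.exp (x n) := by
          rw [← Real.exp_nat_mul, hx]
          congr 1
          ring
  have h4 : Real.exp (x n) - 1 ≤ x n * Real.exp (x n) := by
    have h := Real.add_one_le_exp (-(x n))
    have h5 : Real.exp (-(x n)) * Real.exp (x n) = 1 := by
      rw [← Real.exp_add, neg_add_cancel, Real.exp_zero]
    nlinarith [Real.exp_pos (x n)]
  calc _ ≤ _ := h1
    _ ≤ Real.exp (x n) - 1 := by linarith
    _ ≤ x n * Real.exp (x n) := h4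
    _ ≤ _ := mul_le_mul_of_nonneg_left (Real.exp_le_exp.2 hxn) (hx0 n)

theorem differentiable_weierstrassFactor (n : ℕ+) :
    Differentiable ℂ (fun w => weierstrassFactor w n) := by
  unfold weierstrassFactor
  fun_prop

theorem hasProdLocallyUniformlyOn_weierstrassFactor (R : ℝ) :
    HasProdLocallyUniformlyOn (fun (n : ℕ+) w => weierstrassFactor w n)
      (fun w => ∏' n, weierstrassFactor w n) (Metric.ball 0 R) := by
  obtain ⟨u, hu, hb⟩ := norm_weierstrassFactor_sub_one_le R
  have := hu.hasProdLocallyUniformlyOn_one_add (f := fun (n : ℕ+) w => weierstrassFactor w n - 1)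
    (K := Metric.ball (0 : ℂ) R) Metric.isOpen_ball
    (Filter.Eventually.of_forall fun n w hw => hb n w (mem_ball_zero_iff.1 hw).le)
    (fun n => ((differentiable_weierstrassFactor n).sub_const 1).continuous.continuousOn)
  simpa using this

theorem multipliable_weierstrassFactor (w : ℂ) : Multipliable (weierstrassFactor w) :=
  ((hasProdLocallyUniformlyOn_weierstrassFactor (‖w‖ + 1)).hasProd (by simp)).multipliable

theorem differentiable_weierstrassProduct : Differentiable ℂ weierstrassProduct := by
  refine Differentiable.const_mul (fun w => ?_) _
  have h := (hasProdLocallyUniformlyOn_weierstrassFactor (‖w‖ + 1)).differentiableOn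
    (Filter.Eventually.of_forall fun s => DifferentiableOn.fun_finsetProd fun n _ =>
      (differentiable_weierstrassFactor n).differentiableOn) Metric.isOpen_ball
  exact h.differentiableAt (Metric.isOpen_ball.mem_nhds (by simp))

theorem weierstrassProduct_eq {w : ℂ} (hw : -1 < w.re) :
    weierstrassProduct w = Complex.exp (-deriv (zetaContinuation w) 0) := by
  have hpi : (2 * Real.pi : ℂ) ≠ 0 := by exact_mod_cast Real.two_pi_pos.ne'
  rw [weierstrassProduct, (hasProd_weierstrassFactor hw).tprod_eq]
  field_simp

theorem weierstrassProduct_zero : weierstrassProduct 0 = 1 / (2 * (Real.pi : ℂ)) := by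
  simp [weierstrassProduct, weierstrassFactor]

theorem neg_one_lt_re_sq {k : ℂ} (hk : k ∈ regionK) : -1 < (k ^ 2).re := by
  have h := Real.lt_sqrt (abs_nonneg k.im) |>.1 hk
  rw [sq_abs] at h
  have : (k ^ 2).re = k.re ^ 2 - k.im ^ 2 := by simp [sq]
  rw [this]
  linarith

/-! ### Weak derivatives on an interval -/

theorem integral_edgeMeasure {E : Type*} [NormedAddCommGroup E] [NormedSpace ℝ E] {L : ℝ}
    (hL : 0 ≤ L) (f : ℝ → E) : ∫ x, f x ∂(edgeMeasure L) = ∫ x in (0 : ℝ)..L, f x := by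
  rw [edgeMeasure, integral_Icc_eq_integral_Ioc, intervalIntegral.integral_of_le hL]

theorem memLp_edgeMeasure {g : ℝ → ℂ} (hg : Continuous g) (L : ℝ) :
    MemLp g 2 (edgeMeasure L) := by
  obtain ⟨C, hC⟩ := (isCompact_Icc (a := (0 : ℝ)) (b := L)).exists_bound_of_continuousOn
    hg.continuousOn
  refine MemLp.of_bound hg.aestronglyMeasurable C ?_
  exact (ae_restrict_mem measurableSet_Icc).mono hC

/-- The class in `L²[0, L]` of a continuous function. -/
noncomputable def edgeClass (L : ℝ) {g : ℝ → ℂ} (hg : Continuous g) : EdgeSpace L :=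
  (memLp_edgeMeasure hg L).toLp g

theorem coeFn_edgeClass (L : ℝ) {g : ℝ → ℂ} (hg : Continuous g) :
    edgeClass L hg =ᵐ[edgeMeasure L] g :=
  MemLp.coeFn_toLp _

theorem eq_zero_of_tsupport_subset {L x : ℝ} {φ : ℝ → ℝ} (hs : tsupport φ ⊆ Set.Ioo 0 L)
    (hx : x ∉ Set.Ioo 0 L) : φ x = 0 :=
  image_eq_zero_of_notMem_tsupport fun h => hx (hs h)

/-- A continuously differentiable function has its derivative as weak derivative. -/
theorem hasWeakDeriv_of_hasDerivAt {L : ℝ} (hL : 0 ≤ L) {u v : EdgeSpace L} {f f' : ℝ → ℂ}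
    (hf : ∀ x, HasDerivAt f (f' x) x) (hf' : Continuous f') (hu : u =ᵐ[edgeMeasure L] f)
    (hv : v =ᵐ[edgeMeasure L] f') : HasWeakDeriv u v := by
  intro φ hφ hc hs
  have hd : Continuous (deriv φ) := hφ.continuous_deriv (by simp)
  have hφd : ∀ x, HasDerivAt φ (deriv φ x) x := fun x =>
    (hφ.differentiable (by simp) x).hasDerivAt
  have hfc : Continuous f := continuous_iff_continuousAt.2 fun x => (hf x).continuousAt
  have e1 : ∫ x, deriv φ x • u x ∂(edgeMeasure L) = ∫ x in (0 : ℝ)..L, deriv φ x • f x := by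
    rw [← integral_edgeMeasure hL]
    refine integral_congr_ae ?_
    filter_upwards [hu] with x hx
    rw [hx]
  have e2 : ∫ x, φ x • v x ∂(edgeMeasure L) = ∫ x in (0 : ℝ)..L, φ x • f' x := by
    rw [← integral_edgeMeasure hL]
    refine integral_congr_ae ?_
    filter_upwards [hv] with x hx
    rw [hx]
  have i1 : IntervalIntegrable (fun x => deriv φ x • f x) volume 0 L :=
    (hd.smul hfc).intervalIntegrable _ _
  have i2 : IntervalIntegrable (fun x => φ x • f' x) volume 0 L :=
    (hφ.continuous.smul hf').intervalIntegrable _ _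
  -- Integration by parts for φf; both boundary terms vanish because φ is zero at 0 and L.
  have h := intervalIntegral.integral_eq_sub_of_hasDerivAt (a := 0) (b := L)
    (fun x _ => (hφd x).smul (hf x)) (i2.add i1)
  rw [intervalIntegral.integral_add i2 i1, Pi.smul_apply', Pi.smul_apply',
    eq_zero_of_tsupport_subset hs (x := 0) (by simp),
    eq_zero_of_tsupport_subset hs (x := L) (by simp), zero_smul, zero_smul, sub_zero] at h
  rw [e1, e2]
  exact eq_neg_of_add_eq_zero_right h

theorem exists_subset_Icc_of_isCompact {L : ℝ} (hL : 0 < L) {K : Set ℝ} (hK : IsCompact K)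
    (hs : K ⊆ Set.Ioo 0 L) : ∃ a b, 0 < a ∧ a ≤ b ∧ b < L ∧ K ⊆ Set.Icc a b := by
  rcases K.eq_empty_or_nonempty with rfl | hne
  · exact ⟨L / 2, L / 2, by linarith, le_rfl, by linarith, Set.empty_subset _⟩
  · obtain ⟨a, ha⟩ := hK.exists_isLeast hne
    obtain ⟨b, hb⟩ := hK.exists_isGreatest hne
    exact ⟨a, b, (hs ha.1).1, ha.2 hb.1, (hs hb.1).2, fun x hx => ⟨ha.2 hx, hb.2 hx⟩⟩

/-- A test function of integral zero is the derivative of a test function. -/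
theorem exists_primitive_test {L : ℝ} (hL : 0 < L) {G : ℝ → ℝ} (hG : ContDiff ℝ ∞ G)
    (hc : HasCompactSupport G) (hs : tsupport G ⊆ Set.Ioo 0 L) (h0 : ∫ x in (0 : ℝ)..L, G x = 0) :
    ∃ φ : ℝ → ℝ, ContDiff ℝ ∞ φ ∧ HasCompactSupport φ ∧ tsupport φ ⊆ Set.Ioo 0 L ∧
      deriv φ = G := by
  obtain ⟨a, b, ha, hab, hb, hK⟩ := exists_subset_Icc_of_isCompact hL hc hs
  have hG0 : ∀ x, x ∉ Set.Icc a b → G x = 0 := fun x hx =>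
    image_eq_zero_of_notMem_tsupport fun h => hx (hK h)
  set φ : ℝ → ℝ := fun x => ∫ t in (0 : ℝ)..x, G t with hφ
  have hd : ∀ x, HasDerivAt φ (G x) x := fun x =>
    intervalIntegral.integral_hasDerivAt_right (hG.continuous.intervalIntegrable _ _)
      (hG.continuous.stronglyMeasurableAtFilter _ _) hG.continuous.continuousAt
  have hderiv : deriv φ = G := funext fun x => (hd x).deriv
  have hsupp : Function.support φ ⊆ Set.Icc a b := by
    intro x hx
    by_contra hxn
    apply hx
    rw [Set.mem_Icc, not_and_or, not_le, not_le] at hxn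
    rcases hxn with h | h
    · refine (intervalIntegral.integral_congr (g := fun _ => (0 : ℝ)) fun t ht => ?_).trans (by simp)
      refine hG0 t fun ht' => ?_
      have := (Set.mem_uIcc.1 ht)
      rcases this with h1 | h1 <;> linarith [ht'.1, h1.1, h1.2]
    -- To the right of the support the primitive equals the total integral of G, so here the zero
    -- mean is needed.
    · have e : (∫ t in x..L, G t) = 0 := by
        refine (intervalIntegral.integral_congr (g := fun _ => (0 : ℝ)) fun t ht => ?_).trans
          (by simp)
        refine hG0 t fun ht' => ?_
        have := (Set.mem_uIcc.1 ht)
        rcases this with h1 | h1 <;> linarith [ht'.2, h1.1, h1.2]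
      have := intervalIntegral.integral_add_adjacent_intervals
        (hG.continuous.intervalIntegrable (μ := volume) 0 x)
        (hG.continuous.intervalIntegrable x L)
      rw [e, h0, add_zero] at this
      exact this
  refine ⟨φ, ?_, ?_, ?_, hderiv⟩
  · rw [contDiff_infty_iff_deriv, hderiv]
    exact ⟨fun x => (hd x).differentiableAt, hG⟩
  · exact HasCompactSupport.of_support_subset_isCompact isCompact_Icc hsupp
  · exact (closure_minimal hsupp isClosed_Icc).trans fun x hx =>
      ⟨ha.trans_le hx.1, hx.2.trans_lt hb⟩

theorem exists_test_integral_eq_one {L : ℝ} (hL : 0 < L) :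
    ∃ h : ℝ → ℝ, ContDiff ℝ ∞ h ∧ HasCompactSupport h ∧ tsupport h ⊆ Set.Ioo 0 L ∧
      ∫ x in (0 : ℝ)..L, h x = 1 := by
  let f : ContDiffBump (L / 2) := ⟨L / 8, L / 4, by positivity, by linarith⟩
  have hs : tsupport (f.normed volume) ⊆ Set.Ioo 0 L := by
    rw [f.tsupport_normed_eq, Real.closedBall_eq_Icc]
    intro x hx
    have h1 : L / 2 - L / 4 ≤ x := hx.1
    have h2 : x ≤ L / 2 + L / 4 := hx.2
    constructor <;> linarith
  refine ⟨f.normed volume, f.contDiff_normed, f.hasCompactSupport_normed, hs, ?_⟩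
  rw [← f.integral_normed (μ := volume), intervalIntegral.integral_of_le hL.le]
  refine setIntegral_eq_integral_of_forall_compl_eq_zero fun x hx => ?_
  exact eq_zero_of_tsupport_subset hs fun h => hx ⟨h.1, h.2.le⟩

/-- An element of `L²[0, L]` that is orthogonal to all test functions vanishes. -/
theorem eq_zero_of_integral_smul_eq_zero {L : ℝ} {v : EdgeSpace L}
    (h : ∀ g : ℝ → ℝ, ContDiff ℝ ∞ g → HasCompactSupport g → tsupport g ⊆ Set.Ioo 0 L →
      ∫ x, g x • v x ∂(edgeMeasure L) = 0) : v = 0 := by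
  refine HasWeakDeriv.eq_zero fun φ hφ hc hs => ?_
  rw [h φ hφ hc hs, neg_zero]
  refine integral_eq_zero_of_ae ?_
  filter_upwards [Lp.coeFn_zero ℂ 2 (edgeMeasure L)] with x hx
  rw [hx, Pi.zero_apply, smul_zero]

/-- The lemma of du Bois-Reymond. -/
theorem HasWeakDeriv.eq_const {L : ℝ} (hL : 0 < L) {u : EdgeSpace L} (hu : HasWeakDeriv u 0) :
    ∃ c : ℂ, u =ᵐ[edgeMeasure L] fun _ => c := by
  obtain ⟨h, hh, hhc, hhs, hh1⟩ := exists_test_integral_eq_one hL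
  set c : ℂ := ∫ x, h x • u x ∂(edgeMeasure L) with hcdef
  have hcont : Continuous fun _ : ℝ => c := continuous_const
  refine ⟨c, ?_⟩
  have hcl := coeFn_edgeClass L hcont
  -- For any test g, the function g - (∫g)h has mean zero, hence is φ' for a test φ. Testing u with
  -- it gives ∫gu = (∫g)c.
  have key : u - edgeClass L hcont = 0 := by
    refine eq_zero_of_integral_smul_eq_zero fun g hg hgc hgs => ?_
    set I : ℝ := ∫ x in (0 : ℝ)..L, g x with hI
    have hGd : ContDiff ℝ ∞ (g - I • h) := hg.sub (contDiff_const.smul hh)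
    have hIs : tsupport (I • h) ⊆ tsupport h := tsupport_smul_subset_right (fun _ => I) h
    have hGs : tsupport (g - I • h) ⊆ tsupport g ∪ tsupport h :=
      (tsupport_sub g (I • h)).trans (Set.union_subset_union_right _ hIs)
    have hGc : HasCompactSupport (g - I • h) :=
      (hgc.isCompact.union hhc.isCompact).of_isClosed_subset (isClosed_tsupport _) hGs
    have hG0 : ∫ x in (0 : ℝ)..L, (g - I • h) x = 0 := by
      have : ∫ x in (0 : ℝ)..L, (g x - I * h x) = 0 := by
        rw [intervalIntegral.integral_sub (hg.continuous.intervalIntegrable _ _)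
          ((hh.continuous.const_mul I).intervalIntegrable _ _),
          intervalIntegral.integral_const_mul, hh1, mul_one, ← hI, sub_self]
      exact this
    obtain ⟨φ, hφ, hφc, hφs, hφd⟩ := exists_primitive_test hL hGd hGc
      (hGs.trans (Set.union_subset hgs hhs)) hG0
    have hw := hu φ hφ hφc hφs
    have hz : ∫ x, φ x • (0 : EdgeSpace L) x ∂(edgeMeasure L) = 0 := by
      refine integral_eq_zero_of_ae ?_
      filter_upwards [Lp.coeFn_zero ℂ 2 (edgeMeasure L)] with x hx
      rw [hx, Pi.zero_apply, smul_zero]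
    have i2 : Integrable (fun x => I • (h x • u x)) (edgeMeasure L) :=
      (integrable_smul u hh.continuous hhc).smul I
    have e1 : ∫ x, (g - I • h) x • u x ∂(edgeMeasure L)
        = ∫ x, g x • u x ∂(edgeMeasure L) - I • c := by
      rw [hcdef, ← integral_smul, ← integral_sub (integrable_smul u hg.continuous hgc) i2]
      refine integral_congr_ae (Filter.Eventually.of_forall fun x => ?_)
      simp [sub_smul, mul_smul]
    rw [hφd, hz, neg_zero, e1] at hw
    have e2 : ∫ x, g x • (u - edgeClass L hcont) x ∂(edgeMeasure L)
        = ∫ x, (g x • u x - g x • c) ∂(edgeMeasure L) := by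
      refine integral_congr_ae ?_
      filter_upwards [Lp.coeFn_sub u (edgeClass L hcont), hcl] with x h1 h2
      rw [h1, Pi.sub_apply, h2, smul_sub]
    have e3 : Integrable (fun x => g x • c) (edgeMeasure L) :=
      ((hg.continuous.smul continuous_const).integrable_of_hasCompactSupport
        (hgc.smul_right)).restrict
    rw [e2, integral_sub (integrable_smul u hg.continuous hgc) e3, integral_smul_const,
      integral_edgeMeasure hL.le g]
    exact hw
  rw [sub_eq_zero] at key
  rw [key]
  exact hcl

theorem HasWeakDeriv.sub {L : ℝ} {u₁ v₁ u₂ v₂ : EdgeSpace L} (h₁ : HasWeakDeriv u₁ v₁)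
    (h₂ : HasWeakDeriv u₂ v₂) : HasWeakDeriv (u₁ - u₂) (v₁ - v₂) := by
  have := h₁.add (h₂.smul (-1))
  simpa [sub_eq_add_neg] using this

/-- A function with continuous weak derivative is continuously differentiable. -/
theorem HasWeakDeriv.exists_hasDerivAt {L : ℝ} (hL : 0 < L) {v w : EdgeSpace L}
    (h : HasWeakDeriv v w) {W : ℝ → ℂ} (hW : Continuous W) (hw : w =ᵐ[edgeMeasure L] W) :
    ∃ V : ℝ → ℂ, (∀ x, HasDerivAt V (W x) x) ∧ v =ᵐ[edgeMeasure L] V := by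
  set P : ℝ → ℂ := fun x => ∫ t in (0 : ℝ)..x, W t with hP
  have hd : ∀ x, HasDerivAt P (W x) x := fun x =>
    intervalIntegral.integral_hasDerivAt_right (hW.intervalIntegrable _ _)
      (hW.stronglyMeasurableAtFilter _ _) hW.continuousAt
  have hPc : Continuous P := continuous_iff_continuousAt.2 fun x => (hd x).continuousAt
  have hPw : HasWeakDeriv (edgeClass L hPc) w :=
    hasWeakDeriv_of_hasDerivAt hL.le hd hW (coeFn_edgeClass L hPc) hw
  -- v and the primitive of W have the same weak derivative, so they differ by a constant.
  have h0 := h.sub hPw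
  rw [sub_self] at h0
  obtain ⟨c, hc⟩ := h0.eq_const hL
  refine ⟨fun x => P x + c, fun x => (hd x).add_const c, ?_⟩
  filter_upwards [hc, coeFn_edgeClass L hPc, Lp.coeFn_sub v (edgeClass L hPc)] with x h1 h2 h3
  rw [h1, Pi.sub_apply, h2] at h3
  rw [h3]
  ring

/-! ### Eigenfunctions on an edge -/

theorem continuous_sin_mul (κ : ℂ) : Continuous fun x : ℝ => Complex.sin (κ * x) := by
  fun_prop

theorem continuous_cos_mul (κ : ℂ) : Continuous fun x : ℝ => Complex.cos (κ * x) := by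
  fun_prop

/-- The function `x ↦ sin (κ x)` in `L²[0, L]`. -/
noncomputable def edgeSine (L : ℝ) (κ : ℂ) : EdgeSpace L := edgeClass L (continuous_sin_mul κ)

theorem coeFn_edgeSine (L : ℝ) (κ : ℂ) :
    edgeSine L κ =ᵐ[edgeMeasure L] fun x : ℝ => Complex.sin (κ * x) :=
  coeFn_edgeClass L _

theorem hasDerivAt_sin_mul (κ : ℂ) (x : ℝ) :
    HasDerivAt (fun x : ℝ => Complex.sin (κ * x)) (κ * Complex.cos (κ * x)) x := by
  have h : HasDerivAt (fun x : ℝ => κ * (x : ℂ)) (κ * 1) x :=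
    (Complex.ofRealCLM.hasDerivAt (x := x)).const_mul κ
  exact ((Complex.hasDerivAt_sin _).comp x h).congr_deriv (by ring)

theorem hasDerivAt_cos_mul (κ : ℂ) (x : ℝ) :
    HasDerivAt (fun x : ℝ => Complex.cos (κ * x)) (-κ * Complex.sin (κ * x)) x := by
  have h : HasDerivAt (fun x : ℝ => κ * (x : ℂ)) (κ * 1) x :=
    (Complex.ofRealCLM.hasDerivAt (x := x)).const_mul κ
  exact ((Complex.hasDerivAt_cos _).comp x h).congr_deriv (by ring)

theorem isDirichletSecondDeriv_edgeSine {L : ℝ} (hL : 0 ≤ L) {κ : ℂ}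
    (h : Complex.sin (κ * L) = 0) :
    IsDirichletSecondDeriv (edgeSine L κ) (-(κ ^ 2 • edgeSine L κ)) := by
  have hcos : Continuous fun x : ℝ => κ * Complex.cos (κ * x) :=
    continuous_const.mul (continuous_cos_mul κ)
  refine ⟨⟨edgeClass L hcos, ?_, ?_⟩, _, (continuous_sin_mul κ).continuousOn,
    coeFn_edgeSine L κ, by simp, h⟩
  · exact hasWeakDeriv_of_hasDerivAt hL (hasDerivAt_sin_mul κ) hcos (coeFn_edgeSine L κ)
      (coeFn_edgeClass L hcos)
  · refine hasWeakDeriv_of_hasDerivAt hL (fun x => (hasDerivAt_cos_mul κ x).const_mul κ)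
      (by fun_prop) (coeFn_edgeClass L hcos) ?_
    filter_upwards [coeFn_edgeSine L κ, Lp.coeFn_neg (κ ^ 2 • edgeSine L κ),
      Lp.coeFn_smul (κ ^ 2) (edgeSine L κ)] with x h1 h2 h3
    rw [h2, Pi.neg_apply, h3, Pi.smul_apply, h1, smul_eq_mul]
    ring

/-- The quantities A and B below are conserved, with values 0 and V(0) at x = 0; the combination B
sin - A cos isolates κU. -/
theorem ode_solution {L : ℝ} {κ : ℂ} {U V : ℝ → ℂ}
    (hU : ∀ x, HasDerivAt U (V x) x) (hV : ∀ x ∈ Set.Icc 0 L, HasDerivAt V (-(κ ^ 2 * U x)) x)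
    (h0 : U 0 = 0) {x : ℝ} (hx : x ∈ Set.Icc 0 L) : κ * U x = V 0 * Complex.sin (κ * x) := by
  set A : ℝ → ℂ := fun x => V x * Complex.sin (κ * x) - κ * (U x * Complex.cos (κ * x)) with hA
  set B : ℝ → ℂ := fun x => V x * Complex.cos (κ * x) + κ * (U x * Complex.sin (κ * x)) with hB
  have dA : ∀ x ∈ Set.Icc 0 L, HasDerivAt A 0 x := fun x hx =>
    (((hV x hx).mul (hasDerivAt_sin_mul κ x)).sub
      (((hU x).mul (hasDerivAt_cos_mul κ x)).const_mul κ)).congr_deriv (by ring)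
  have dB : ∀ x ∈ Set.Icc 0 L, HasDerivAt B 0 x := fun x hx =>
    (((hV x hx).mul (hasDerivAt_cos_mul κ x)).add
      (((hU x).mul (hasDerivAt_sin_mul κ x)).const_mul κ)).congr_deriv (by ring)
  have cA := constant_of_has_deriv_right_zero
    (fun x hx => (dA x hx).continuousAt.continuousWithinAt)
    (fun x hx => (dA x ⟨hx.1, hx.2.le⟩).hasDerivWithinAt) x hx
  have cB := constant_of_has_deriv_right_zero
    (fun x hx => (dB x hx).continuousAt.continuousWithinAt)
    (fun x hx => (dB x ⟨hx.1, hx.2.le⟩).hasDerivWithinAt) x hx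
  simp only [hA, hB, h0, Complex.ofReal_zero, mul_zero, Complex.sin_zero, Complex.cos_zero,
    sub_zero, add_zero, mul_one] at cA cB
  have hsc := Complex.sin_sq_add_cos_sq (κ * x)
  linear_combination Complex.sin (κ * x) * cB - Complex.cos (κ * x) * cA - κ * U x * hsc

/-- The regularity of an eigenfunction on an edge. -/
theorem IsDirichletSecondDeriv.exists_ode {L : ℝ} (hL : 0 < L) {μ : ℂ} {u : EdgeSpace L}
    (h : IsDirichletSecondDeriv u (-(μ • u))) :
    ∃ U V : ℝ → ℂ, (∀ x, HasDerivAt U (V x) x) ∧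
      (∀ x ∈ Set.Icc 0 L, HasDerivAt V (-(μ * U x)) x) ∧ U 0 = 0 ∧ U L = 0 ∧
      u =ᵐ[edgeMeasure L] U := by
  obtain ⟨⟨v, huv, hvw⟩, f, hf, huf, hf0, hfL⟩ := h
  -- f is continuous only on [0, L]; its extension by constants is continuous on ℝ and so has
  -- primitives everywhere.
  set F : ℝ → ℂ := Set.IccExtend hL.le (Set.domRestrict (Set.Icc 0 L) f) with hF
  have hFc : Continuous F := hf.domRestrict.Icc_extend'
  have hFf : Set.EqOn F f (Set.Icc 0 L) := fun x hx => by
    rw [hF, Set.IccExtend_of_mem hL.le _ hx, Set.domRestrict_apply]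
  have hmem : ∀ᵐ x ∂(edgeMeasure L), x ∈ Set.Icc 0 L := ae_restrict_mem measurableSet_Icc
  have huF : u =ᵐ[edgeMeasure L] F := by
    filter_upwards [huf, hmem] with x h1 h2
    rw [h1, hFf h2]
  have hwW : (-(μ • u) : EdgeSpace L) =ᵐ[edgeMeasure L] fun x => -(μ * F x) := by
    filter_upwards [huF, Lp.coeFn_neg (μ • u), Lp.coeFn_smul μ u] with x h1 h2 h3
    rw [h2, Pi.neg_apply, h3, Pi.smul_apply, h1, smul_eq_mul]
  obtain ⟨V, hV, hvV⟩ := hvw.exists_hasDerivAt hL (by fun_prop) hwW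
  have hVc : Continuous V := continuous_iff_continuousAt.2 fun x => (hV x).continuousAt
  obtain ⟨U, hU, huU⟩ := huv.exists_hasDerivAt hL hVc hvV
  have hUc : Continuous U := continuous_iff_continuousAt.2 fun x => (hU x).continuousAt
  -- Continuous functions equal almost everywhere on a nondegenerate interval agree at its ends too,
  -- so U inherits the boundary values.
  have hUF : Set.EqOn U F (Set.Icc 0 L) :=
    Measure.eqOn_Icc_of_ae_eq volume hL.ne (huU.symm.trans huF) hUc.continuousOn hFc.continuousOn
  have h0 : (0 : ℝ) ∈ Set.Icc 0 L := Set.left_mem_Icc.2 hL.le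
  have h1 : L ∈ Set.Icc 0 L := Set.right_mem_Icc.2 hL.le
  refine ⟨U, V, hU, fun x hx => ?_, ?_, ?_, huU⟩
  · rw [hUF hx]
    exact hV x
  · rw [hUF h0, hFf h0, hf0]
  · rw [hUF h1, hFf h1, hfL]

/-- The second conjunct is the Dirichlet condition at L: it kills the coefficient unless κL is a
zero of the sine. -/
theorem IsDirichletSecondDeriv.eq_smul_edgeSine {L : ℝ} (hL : 0 < L) {κ : ℂ} (hκ : κ ≠ 0)
    {u : EdgeSpace L} (h : IsDirichletSecondDeriv u (-(κ ^ 2 • u))) :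
    ∃ c : ℂ, u = c • edgeSine L κ ∧ c * Complex.sin (κ * L) = 0 := by
  obtain ⟨U, V, hU, hV, h0, h1, hu⟩ := h.exists_ode hL
  have hs := fun {x : ℝ} (hx : x ∈ Set.Icc 0 L) => ode_solution hU hV h0 hx
  refine ⟨V 0 / κ, ?_, ?_⟩
  · refine Lp.ext ?_
    have hmem : ∀ᵐ x ∂(edgeMeasure L), x ∈ Set.Icc 0 L := ae_restrict_mem measurableSet_Icc
    filter_upwards [hu, coeFn_edgeSine L κ, Lp.coeFn_smul (V 0 / κ) (edgeSine L κ), hmem]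
      with x h2 h3 h4 h5
    rw [h2, h4, Pi.smul_apply, h3, smul_eq_mul, div_mul_eq_mul_div, ← hs h5,
      mul_div_cancel_left₀ _ hκ]
  · rw [div_mul_eq_mul_div, ← hs (Set.right_mem_Icc.2 hL.le), h1, mul_zero, zero_div]

/-- For κ = 0 the sine degenerates; U is instead linear, U = V(0)x, and U(L) = 0 forces V(0) = 0. -/
theorem IsDirichletSecondDeriv.eq_zero_of_harmonic {L : ℝ} (hL : 0 < L)
    {u : EdgeSpace L} (h : IsDirichletSecondDeriv u (-((0 : ℂ) • u))) : u = 0 := by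
  obtain ⟨U, V, hU, hV, h0, h1, hu⟩ := h.exists_ode hL
  have cV : ∀ x ∈ Set.Icc 0 L, V x = V 0 := constant_of_has_deriv_right_zero
    (fun x hx => (hV x hx).continuousAt.continuousWithinAt)
    (fun x hx => by simpa using (hV x ⟨hx.1, hx.2.le⟩).hasDerivWithinAt)
  have dA : ∀ x ∈ Set.Icc 0 L, HasDerivAt (fun x : ℝ => U x - V 0 * x) 0 x := fun x hx =>
    ((hU x).sub ((Complex.ofRealCLM.hasDerivAt (x := x)).const_mul (V 0))).congr_deriv
      (by simp [cV x hx])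
  have cA := constant_of_has_deriv_right_zero
    (fun x hx => (dA x hx).continuousAt.continuousWithinAt)
    (fun x hx => (dA x ⟨hx.1, hx.2.le⟩).hasDerivWithinAt)
  have hL' : (L : ℂ) ≠ 0 := by exact_mod_cast hL.ne'
  have hV0 : V 0 = 0 := by
    have := cA L (Set.right_mem_Icc.2 hL.le)
    simpa [h0, h1, hL'] using this
  refine (Lp.eq_zero_iff_ae_eq_zero).2 ?_
  have hmem : ∀ᵐ x ∂(edgeMeasure L), x ∈ Set.Icc 0 L := ae_restrict_mem measurableSet_Icc
  filter_upwards [hu, hmem] with x h2 h3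
  have := cA x h3
  rw [h2, Pi.zero_apply]
  simpa [h0, hV0] using this

/-! ### The spectrum of the Laplacian -/

/-- The space of eigenvectors of `-Δ` for `μ`, as a subspace of the Hilbert space. -/
noncomputable def eigenvectors (μ : ℂ) : Submodule ℂ GraphSpace :=
  laplacianGraph.comap (LinearMap.prod LinearMap.id (-(μ • LinearMap.id)))

theorem mem_eigenvectors {μ : ℂ} {ψ : GraphSpace} :
    ψ ∈ eigenvectors μ ↔ ∀ n, IsDirichletSecondDeriv (ψ n) (-(μ • ψ n)) :=
  Iff.rfl

/-- The inclusion of the domain is injective, so the eigenspace keeps its dimension inside the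
Hilbert space, where it is described edge by edge. -/
theorem multiplicity_eq_finrank (μ : ℂ) :
    multiplicity (-laplacian) μ = Module.finrank ℂ (eigenvectors μ) := by
  rw [multiplicity, ← Submodule.finrank_map_subtype_eq]
  suffices h : (LinearMap.ker ((-laplacian).toFun - μ • (-laplacian).domain.subtype)).map
      (-laplacian).domain.subtype = eigenvectors μ by rw [h]
  ext ψ
  have hg : ψ ∈ eigenvectors μ ↔ (ψ, -(μ • ψ)) ∈ laplacian.graph := by
    rw [laplacian_graph]
    rfl
  rw [hg, LinearPMap.mem_graph_iff, Submodule.mem_map]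
  constructor
  · rintro ⟨y, hy, rfl⟩
    refine ⟨y, rfl, ?_⟩
    have h : -laplacian y - μ • (y : GraphSpace) = 0 := hy
    change laplacian y = -(μ • (y : GraphSpace))
    rw [← sub_eq_zero.1 h, neg_neg]
  · rintro ⟨y, hy, h⟩
    refine ⟨y, ?_, hy⟩
    have h' : -laplacian y - μ • (y : GraphSpace) = 0 := by
      rw [h, hy, neg_neg, sub_self]
    exact h'

theorem edgeLength_pos (n : ℕ+) : 0 < edgeLength n :=
  div_pos Real.pi_pos (by exact_mod_cast n.pos)

theorem sin_mul_edgeLength_eq_zero_iff (κ : ℂ) (n : ℕ+) :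
    Complex.sin (κ * edgeLength n) = 0 ↔ ∃ m : ℤ, κ = m * (n : ℂ) := by
  have hn : (n : ℂ) ≠ 0 := by exact_mod_cast n.ne_zero
  have hpi : (Real.pi : ℂ) ≠ 0 := by exact_mod_cast Real.pi_ne_zero
  rw [Complex.sin_eq_zero_iff]
  refine exists_congr fun m => ?_
  rw [edgeLength]
  push_cast
  rw [← mul_div_assoc, div_eq_iff hn, mul_right_comm, mul_left_inj' hpi]

theorem sin_natCast_mul_edgeLength_eq_zero_iff (N n : ℕ+) :
    Complex.sin ((N : ℂ) * edgeLength n) = 0 ↔ (n : ℕ) ∣ N := by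
  rw [sin_mul_edgeLength_eq_zero_iff, ← Int.natCast_dvd_natCast]
  constructor
  · rintro ⟨m, hm⟩
    exact ⟨m, by rw [mul_comm]; exact_mod_cast hm⟩
  · rintro ⟨m, hm⟩
    exact ⟨m, by rw [mul_comm]; exact_mod_cast hm⟩

/-- The eigenvalues of `-Δ` are the squares of the positive integers. -/
theorem eigenvectors_eq_bot {μ : ℂ} (hμ : μ ∉ Set.range fun N : ℕ+ => (N : ℂ) ^ 2) :
    eigenvectors μ = ⊥ := by
  rw [Submodule.eq_bot_iff]
  intro ψ hψ
  rw [mem_eigenvectors] at hψ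
  refine lp.ext (funext fun n => ?_)
  have hn := hψ n
  -- A complex square root handles every μ at once; neither reality nor positivity of the spectrum
  -- is presupposed.
  obtain ⟨κ, hκ⟩ := IsAlgClosed.exists_pow_nat_eq μ (n := 2) (by norm_num)
  rcases eq_or_ne κ 0 with rfl | h0
  · rw [← hκ, zero_pow two_ne_zero] at hn
    exact hn.eq_zero_of_harmonic (edgeLength_pos n)
  · rw [← hκ] at hn
    obtain ⟨c, hc, hcs⟩ := hn.eq_smul_edgeSine (edgeLength_pos n) h0
    rcases mul_eq_zero.1 hcs with rfl | hs
    · rw [hc, zero_smul]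
      rfl
    · obtain ⟨m, rfl⟩ := (sin_mul_edgeLength_eq_zero_iff κ n).1 hs
      have hm : m ≠ 0 := by
        rintro rfl
        simp at h0
      refine absurd ⟨(m.natAbs.toPNat (Int.natAbs_pos.2 hm)) * n, ?_⟩ hμ
      have hsq : ((m.natAbs : ℂ)) ^ 2 = (m : ℂ) ^ 2 := by
        rw [← Int.cast_natCast, ← Int.cast_pow, Int.natAbs_sq, Int.cast_pow]
      have e : ((m.natAbs.toPNat (Int.natAbs_pos.2 hm) * n : ℕ+) : ℕ) = m.natAbs * n := rfl
      change (((m.natAbs.toPNat (Int.natAbs_pos.2 hm) * n : ℕ+) : ℕ) : ℂ) ^ 2 = μ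
      rw [e, Nat.cast_mul, ← hκ, mul_pow, mul_pow, hsq]

theorem edgeSine_ne_zero {N n : ℕ+} (h : (n : ℕ) ∣ N) : edgeSine (edgeLength n) N ≠ 0 := by
  intro h0
  have hN : (0 : ℝ) < (N : ℕ) := by exact_mod_cast N.pos
  have hn : (0 : ℝ) < (n : ℕ) := by exact_mod_cast n.pos
  have hle : ((n : ℕ) : ℝ) ≤ (N : ℕ) := by exact_mod_cast Nat.le_of_dvd N.pos h
  have hae := (coeFn_edgeSine (edgeLength n) N).symm.trans ((Lp.eq_zero_iff_ae_eq_zero).1 h0)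
  have heq := Measure.eqOn_Icc_of_ae_eq volume (edgeLength_pos n).ne hae
    (continuous_sin_mul N).continuousOn continuousOn_const
  -- At this point sin(Nx) = 1; it lies on the edge because n ≤ N.
  have hmem : Real.pi / (2 * (N : ℕ)) ∈ Set.Icc 0 (edgeLength n) := by
    refine ⟨by positivity, ?_⟩
    rw [edgeLength]
    gcongr
    linarith
  have h1 := heq hmem
  have hN' : (N : ℂ) ≠ 0 := by exact_mod_cast N.ne_zero
  have e : (N : ℂ) * ((Real.pi / (2 * (N : ℕ)) : ℝ) : ℂ) = Real.pi / 2 := by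
    push_cast
    field_simp
  simp only [e, Complex.sin_pi_div_two] at h1
  exact one_ne_zero h1

/-- The edge belonging to a divisor. -/
def divisorEdge (N : ℕ+) (d : {d // d ∈ (N : ℕ).divisors}) : ℕ+ :=
  ⟨d, Nat.pos_of_mem_divisors d.2⟩

theorem divisorEdge_injective (N : ℕ+) : Function.Injective (divisorEdge N) := by
  intro d e h
  exact Subtype.ext (congrArg PNat.val h)

/-- The eigenvectors `sin (N x)`, each supported on an edge whose index divides `N`. -/
noncomputable def eigenbasis (N : ℕ+) (d : {d // d ∈ (N : ℕ).divisors}) : GraphSpace :=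
  lp.single 2 (divisorEdge N d) (edgeSine (edgeLength (divisorEdge N d)) N)

theorem divisorEdge_dvd (N : ℕ+) (d : {d // d ∈ (N : ℕ).divisors}) :
    (divisorEdge N d : ℕ) ∣ N :=
  Nat.dvd_of_mem_divisors d.2

theorem isDirichletSecondDeriv_zero {L : ℝ} (μ : ℂ) :
    IsDirichletSecondDeriv (0 : EdgeSpace L) (-(μ • (0 : EdgeSpace L))) := by
  rw [smul_zero, neg_zero]
  exact ⟨⟨0, hasWeakDeriv_zero, hasWeakDeriv_zero⟩,
    ⟨fun _ => 0, continuousOn_const, Lp.coeFn_zero ℂ 2 _, rfl, rfl⟩⟩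

theorem eigenbasis_mem (N : ℕ+) (d : {d // d ∈ (N : ℕ).divisors}) :
    eigenbasis N d ∈ eigenvectors ((N : ℂ) ^ 2) := by
  rw [mem_eigenvectors]
  intro n
  rcases eq_or_ne n (divisorEdge N d) with rfl | hn
  · rw [eigenbasis, lp.single_apply_self]
    exact isDirichletSecondDeriv_edgeSine (edgeLength_pos _).le
      ((sin_natCast_mul_edgeLength_eq_zero_iff N _).2 (divisorEdge_dvd N d))
  · rw [eigenbasis, lp.single_apply_ne _ _ _ hn]
    exact isDirichletSecondDeriv_zero _

/-- Distinct divisors give distinct edges, so each edge sees a single basis vector. Linear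
independence and spanning both rest on this. -/
theorem sum_smul_eigenbasis_apply (N : ℕ+) (c : {d // d ∈ (N : ℕ).divisors} → ℂ)
    (d : {d // d ∈ (N : ℕ).divisors}) :
    (∑ e, c e • eigenbasis N e) (divisorEdge N d)
      = c d • edgeSine (edgeLength (divisorEdge N d)) N := by
  rw [lp.coeFn_sum, Finset.sum_apply, Finset.sum_eq_single d]
  · rw [lp.coeFn_smul, Pi.smul_apply, eigenbasis, lp.single_apply_self]
  · intro e _ he
    rw [lp.coeFn_smul, Pi.smul_apply, eigenbasis,
      lp.single_apply_ne _ _ _ fun h => he (divisorEdge_injective N h).symm, smul_zero]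
  · simp

theorem linearIndependent_eigenbasis (N : ℕ+) : LinearIndependent ℂ (eigenbasis N) := by
  rw [Fintype.linearIndependent_iff]
  intro c hc d
  have h := sum_smul_eigenbasis_apply N c d
  rw [hc] at h
  exact (smul_eq_zero.1 h.symm).resolve_right (edgeSine_ne_zero (divisorEdge_dvd N d))

theorem span_eigenbasis (N : ℕ+) :
    Submodule.span ℂ (Set.range (eigenbasis N)) = eigenvectors ((N : ℂ) ^ 2) := by
  refine le_antisymm (Submodule.span_le.2 ?_) fun ψ hψ => ?_
  · rintro _ ⟨d, rfl⟩
    exact eigenbasis_mem N d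
  · rw [mem_eigenvectors] at hψ
    have hN : (N : ℂ) ≠ 0 := by exact_mod_cast N.ne_zero
    choose c hc hcs using fun n => (hψ n).eq_smul_edgeSine (edgeLength_pos n) hN
    have e : ψ = ∑ d, c (divisorEdge N d) • eigenbasis N d := by
      refine lp.ext (funext fun n => ?_)
      by_cases hn : (n : ℕ) ∣ N
      · set d : {d // d ∈ (N : ℕ).divisors} := ⟨n, Nat.mem_divisors.2 ⟨hn, N.ne_zero⟩⟩
        have hd : divisorEdge N d = n := rfl
        have := sum_smul_eigenbasis_apply N (fun d => c (divisorEdge N d)) d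
        rw [hd] at this
        rw [this]
        exact hc n
      · have hs : Complex.sin ((N : ℂ) * edgeLength n) ≠ 0 := fun h =>
          hn ((sin_natCast_mul_edgeLength_eq_zero_iff N n).1 h)
        rw [hc n, (mul_eq_zero.1 (hcs n)).resolve_right hs, zero_smul, lp.coeFn_sum,
          Finset.sum_apply]
        refine (Finset.sum_eq_zero fun d _ => ?_).symm
        rw [lp.coeFn_smul, Pi.smul_apply, eigenbasis, lp.single_apply_ne, smul_zero]
        rintro rfl
        exact hn (divisorEdge_dvd N d)
    rw [e]
    exact Submodule.sum_mem _ fun d _ =>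
      Submodule.smul_mem _ _ (Submodule.subset_span ⟨d, rfl⟩)

theorem multiplicity_sq (N : ℕ+) :
    multiplicity (-laplacian) ((N : ℂ) ^ 2) = (N : ℕ).divisors.card := by
  rw [multiplicity_eq_finrank, ← span_eigenbasis,
    finrank_span_eq_card (linearIndependent_eigenbasis N), Fintype.card_coe]

theorem multiplicity_eq_zero {μ : ℂ} (hμ : μ ∉ Set.range fun N : ℕ+ => (N : ℂ) ^ 2) :
    multiplicity (-laplacian) μ = 0 := by
  rw [multiplicity_eq_finrank, eigenvectors_eq_bot hμ, finrank_bot]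

theorem sq_injective : Function.Injective fun N : ℕ+ => (N : ℂ) ^ 2 := by
  intro M N h
  have h' : (M : ℕ) ^ 2 = (N : ℕ) ^ 2 := by
    have h : (M : ℂ) ^ 2 = (N : ℂ) ^ 2 := h
    exact_mod_cast h
  exact PNat.coe_injective (Nat.pow_left_injective two_ne_zero h')

/-- The sum over all complex μ is supported on the squares N², which are reindexed by N. -/
theorem hasSum_zetaTerm {s k : ℂ} (hk : k ∈ regionK) (hs : 1 / 2 < s.re) :
    HasSum (zetaTerm s k) (zetaContinuation (k ^ 2) s) := by
  have h0 : ∀ μ ∉ Set.range fun N : ℕ+ => (N : ℂ) ^ 2, zetaTerm s k μ = 0 := fun μ hμ => by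
    rw [zetaTerm, multiplicity_eq_zero hμ, Nat.cast_zero, zero_mul]
  rw [← sq_injective.hasSum_iff h0]
  refine (hasSum_zetaContinuation (neg_one_lt_re_sq hk) hs).congr_fun fun n => ?_
  rw [Function.comp_apply, zetaTerm, multiplicity_sq]

theorem spectralZeta_eq {s k : ℂ} (hk : k ∈ regionK) (hs : 1 / 2 < s.re) :
    spectralZeta s k = zetaContinuation (k ^ 2) s :=
  (hasSum_zetaTerm hk hs).tsum_eq

theorem isZetaContinuation_zetaContinuation {k : ℂ} (hk : k ∈ regionK) :
    IsZetaContinuation k (zetaContinuation (k ^ 2)) :=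
  ⟨meromorphic_zetaContinuation (neg_one_lt_re_sq hk),
    analyticAt_zetaContinuation_zero (neg_one_lt_re_sq hk),
    fun _ hs => (spectralZeta_eq hk hs).symm⟩

theorem zetaDet_eq_weierstrassProduct {k : ℂ} (hk : k ∈ regionK) :
    zetaDet k = weierstrassProduct (k ^ 2) := by
  rw [(isZetaContinuation_zetaContinuation hk).zetaDet_eq,
    weierstrassProduct_eq (neg_one_lt_re_sq hk)]

theorem zero_mem_regionK : (0 : ℂ) ∈ regionK := by
  simp [regionK]

end QuantumGraph

open QuantumGraph in
theorem theorem9 :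
    -- for `k ∈ K` and `Re s > 1/2` the trace converges
    (∀ k ∈ regionK, ∀ s : ℂ, 1 / 2 < s.re →
      Summable (zetaTerm s k) ∧
      HasSum (fun n : ℕ+ => ((n : ℕ).divisors.card : ℂ) * ((n : ℂ) ^ 2 + k ^ 2) ^ (-s))
        (spectralZeta s k)) ∧
    -- for `k ∈ K` the functional determinant is well defined
    (∀ k ∈ regionK,
      (∃ Z, IsZetaContinuation k Z) ∧
      ∀ Z, IsZetaContinuation k Z → zetaDet k = Complex.exp (-deriv Z 0)) ∧
    -- it extends to an entire function, which is the convergent Weierstrass product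
    (∃ F : ℂ → ℂ, Differentiable ℂ F ∧ (∀ k ∈ regionK, F k = zetaDet k) ∧
      ∀ k : ℂ, Multipliable (weierstrassFactor (k ^ 2)) ∧ F k = weierstrassProduct (k ^ 2)) ∧
    -- the value at `k = 0`
    zetaDet 0 = 1 / (2 * (Real.pi : ℂ)) ∧
    weierstrassProduct 0 = 1 / (2 * (Real.pi : ℂ)) := by
  refine ⟨fun k hk s hs => ⟨(hasSum_zetaTerm hk hs).summable, ?_⟩, fun k hk =>
    ⟨⟨_, isZetaContinuation_zetaContinuation hk⟩, fun Z hZ => hZ.zetaDet_eq⟩,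
    ⟨fun k => weierstrassProduct (k ^ 2), ?_, fun k hk =>
      (zetaDet_eq_weierstrassProduct hk).symm, fun k =>
      ⟨multipliable_weierstrassFactor _, rfl⟩⟩, ?_, weierstrassProduct_zero⟩
  · rw [spectralZeta_eq hk hs]
    exact hasSum_zetaContinuation (neg_one_lt_re_sq hk) hs
  · exact differentiable_weierstrassProduct.comp (differentiable_id.pow 2)
  · rw [zetaDet_eq_weierstrassProduct zero_mem_regionK, zero_pow two_ne_zero,
      weierstrassProduct_zero]
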